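/- For a real one-variable polynomial $f$ and an angle $\theta\in\mathbb R$, put $$F_{f,\theta}(x,y)=f(\cos\theta\,x+\sin\theta\,y)-(-\sin\theta\,x+\cos\theta\,y).$$ The zero set $\{F_{f,\theta}=0\}\subset\mathbb R^2$ is called a polynomial curve (a rotated graph of $f$); $\{F_{f,\theta}>0\}$ is called an open polynomial half plane. An open polynomial curve is a whole polynomial curve $\{F_{g,\theta}=0\}$, or an open half of it (the part where $u:=\cos\theta\,x+\sin\theta\,y$ satisfies $u>a$, or $u<a$), or an open bounded interval of it (the part where $a<u<b$, for some $a<b$). A side is the part of a polynomial curve lying over a nondegenerate closed interval, bounded or not, of values of $u$. A region of type I is a closed simply connected set $T\subseteq\mathbb R^2$ that is the closure of its nonempty connected interior and whose boundary is a union of finitely many sides (possibly none). A region of type II is a region of type I without its boundary. A shortest-length curve in $X\subseteq\mathbb R^2$ is a piecewise $C^2$ curve $\gamma:[a,b]\to X$ whose length is minimal among all piecewise $C^2$ curves in $X$ from $\gamma(a)$ to $\gamma(b)$. Its interactions with a set $e$ are the connected components of $\{t\in[a,b]:\gamma(t)\in e\}$. A cell decomposition of $X$ is a CW complex structure on $X$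 (possibly with infinitely many cells); its cells are the open cells. Theorem. Let $m,k\ge 0$, let $g_1,\dots,g_m,f_1,\dots,f_k$ be real one-variable polynomials, let $\theta_1,\dots,\theta_m,\beta_1,\dots,\beta_k\in\mathbb R$, and let $$X=\bigcap_{i=1}^m\{F_{g_i,\theta_i}=0\}\ \cap\ \bigcap_{j=1}^k\{F_{f_j,\beta_j}>0\}\subseteq\mathbb R^2 .$$ Then $X$ is either empty, or a set of finitely many points, or a disjoint union of finitely many open polynomial curves, all contained in one polynomial curve, or a disjoint union of finitely many regions of type II. Moreover, $X$ has a cell decomposition such that every shortest-length curve between two points of $X$ interacts with each cell at most finitely many times. -/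

import Mathlib

/-- The Euclidean plane. -/
abbrev Plane : Type := EuclideanSpace ℝ (Fin 2)

/-- First coordinate of `p` in the frame obtained from the standard one by rotating by `θ`. -/
noncomputable def frameX (θ : ℝ) (p : Plane) : ℝ := Real.cos θ * p 0 + Real.sin θ * p 1

/-- Second coordinate of `p` in the frame obtained from the standard one by rotating by `θ`. -/
noncomputable def frameY (θ : ℝ) (p : Plane) : ℝ := -Real.sin θ * p 0 + Real.cos θ * p 1

/-- The function `(x, y) ↦ f (cos θ x + sin θ y) - (-sin θ x + cos θ y)`. -/
noncomputable def rotatedFun (f : Polynomial ℝ) (θ : ℝ) (p : Plane) : ℝ :=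
  f.eval (frameX θ p) - frameY θ p

/-- The polynomial curve `{f = 0}`: the graph of `f`, rotated by `θ`. -/
def polyCurve (f : Polynomial ℝ) (θ : ℝ) : Set Plane := {p | rotatedFun f θ p = 0}

/-- The open polynomial half plane `{f > 0}`: the region strictly below the graph of `f`,
rotated by `θ`. -/
def openPolyHalfPlane (f : Polynomial ℝ) (θ : ℝ) : Set Plane := {p | 0 < rotatedFun f θ p}

/-- The part of the rotated graph of `f` lying over `I`. -/
def polyArc (f : Polynomial ℝ) (θ : ℝ) (I : Set ℝ) : Set Plane :=
  {p | p ∈ polyCurve f θ ∧ frameX θ p ∈ I}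

/-- `C` is an open polynomial curve contained in the polynomial curve of `(g, θ)`: the whole curve,
an open half of it, or an open bounded interval of it. -/
def IsOpenPolyCurveOn (g : Polynomial ℝ) (θ : ℝ) (C : Set Plane) : Prop :=
  C = polyCurve g θ ∨
  (∃ a : ℝ, C = polyArc g θ (Set.Ioi a) ∨ C = polyArc g θ (Set.Iio a)) ∨
  ∃ a b : ℝ, a < b ∧ C = polyArc g θ (Set.Ioo a b)

/-- A side: the part of a rotated graph of a polynomial lying over a nondegenerate closed interval
(bounded or not). -/
def IsPolySide (S : Set Plane) : Prop :=
  ∃ (f : Polynomial ℝ) (θ : ℝ) (I : Set ℝ),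
    IsClosed I ∧ I.OrdConnected ∧ I.Nontrivial ∧ S = polyArc f θ I

/-- A region of type I: a simply connected closed region (the closure of its interior, which is
nonempty and connected) whose boundary consists of finitely many sides. The boundary may be empty
or disconnected, and the region may be unbounded. -/
structure IsTypeIRegion (T : Set Plane) : Prop where
  isClosed : IsClosed T
  isSimplyConnected : IsSimplyConnected T
  isConnected_interior : IsConnected (interior T)
  closure_interior : closure (interior T) = T
  sides : ∃ (n : ℕ) (S : Fin n → Set Plane), (∀ i, IsPolySide (S i)) ∧ frontier T = ⋃ i, S i

/-- A region of type II: a region of type I without its boundary. -/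
def IsTypeIIRegion (U : Set Plane) : Prop := ∃ T : Set Plane, IsTypeIRegion T ∧ U = T \ frontier T

/-- `X` is the disjoint union of finitely many sets satisfying `P`. -/
def IsFiniteDisjointUnionOf (P : Set Plane → Prop) (X : Set Plane) : Prop :=
  ∃ (n : ℕ) (U : Fin n → Set Plane),
    (∀ i, P (U i)) ∧ Pairwise (fun i j => Disjoint (U i) (U j)) ∧ X = ⋃ i, U i

/-- `γ` is a piecewise `C²` curve on `[a, b]`: it is continuous, and off a finite set `P` of break
points it is `C²`, up to the end points on each closed piece. -/
def IsPiecewiseC2 (γ : ℝ → Plane) (a b : ℝ) : Prop :=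
  ContinuousOn γ (Set.Icc a b) ∧
  ∃ P : Set ℝ, P.Finite ∧ ∀ s t : ℝ, a ≤ s → s < t → t ≤ b → Disjoint (Set.Ioo s t) P →
    ContDiffOn ℝ 2 γ (Set.Icc s t)

/-- `γ : [a, b] → ℝ²` is a piecewise `C²` curve contained in `X` whose length is least among all
piecewise `C²` curves in `X` with the same initial and final points. The length is the supremum of
the lengths of the inscribed polygonal lines. -/
def IsShortestCurve (X : Set Plane) (γ : ℝ → Plane) (a b : ℝ) : Prop :=
  a ≤ b ∧ IsPiecewiseC2 γ a b ∧ Set.MapsTo γ (Set.Icc a b) X ∧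
  ∀ (δ : ℝ → Plane) (c d : ℝ), c ≤ d → IsPiecewiseC2 δ c d → Set.MapsTo δ (Set.Icc c d) X →
    δ c = γ a → δ d = γ b → eVariationOn γ (Set.Icc a b) ≤ eVariationOn δ (Set.Icc c d)

/-- The curve `γ` on `[a, b]` interacts with `e` finitely many times. One interaction is one stay of
the curve in `e`, from entering to leaving: a connected component of `{t ∈ [a, b] | γ t ∈ e}`. -/
def InteractsFinitely (γ : ℝ → Plane) (a b : ℝ) (e : Set Plane) : Prop :=
  Finite (ConnectedComponents {t : ℝ // t ∈ Set.Icc a b ∧ γ t ∈ e})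

/-- A cell decomposition of `X`: a CW complex structure on the topological space `X`. -/
abbrev CellDecomposition (X : Set Plane) : Type 1 :=
  Topology.CWComplex (Set.univ : Set (X : Type))

/-- The `n`-dimensional open cell with index `i`, as a subset of the plane. -/
def CellDecomposition.openCell {X : Set Plane} (K : CellDecomposition X) (n : ℕ) (i : K.cell n) :
    Set Plane :=
  Subtype.val '' (K.map n i '' Metric.ball 0 1)

/-! Along a rotated graph, parametrized by `u`, the defining function of any other polynomial curve
is a polynomial in `u`. Hence two polynomial curves coincide or meet in finitely many points
(`finite_polyCurve_inter`): if that polynomial is zero, one properly embedded line contains the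
other and so equals it. With at least one equation, `X` is cut out of a single curve by polynomial
equations and strict inequalities in `u`; it is therefore finite or the part over finitely many open
intervals (`finite_or_eq_polyArc`).

With no equation, `X` is a union of components `U` of the complement of a finite arrangement of
curves. There are finitely many of them, because each one other than the whole plane has an arc of
the arrangement in its frontier and an arc borders at most two; the frontier is a union of such
arcs. The delicate point is the simple connectedness of `closure U`. It is a retract of the plane
(`isRetract_closure_component`), by induction on the number of curves. When a new curve cuts `U'`
out of `U`, each component `Z` of `U \ closure U'` is folded onto `closure Z ∩ closure (U \ Z)`.
This set is connected by unicoherence and lies on the new curve up to finitely many points, so it is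
a point or an interval of that curve, hence itself a retract of the plane.

For the cells: if the segment between two points of a shortest curve lies in `X`, the curve follows
it (`IsShortestCurve.mem_segment`). So a shortest curve meets a convex cell during a single time
interval, and an open `X` is decomposed into dyadic cubes that get finer towards the boundary. On a
polynomial curve the same lemma, applied to degenerate segments, shows that a shortest curve never
returns to a point it has left, so it visits each sub-arc once. A finite `X` is discrete. -/

open Set Topology

/-! ### Retracts and unicoherence -/

/-- `T` is a retract of the ambient space. -/
def IsRetract {E : Type*} [TopologicalSpace E] (T : Set E) : Prop :=
  ∃ r : E → E, Continuous r ∧ (∀ x, r x ∈ T) ∧ ∀ x ∈ T, r x = x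

theorem isRetract_univ {E : Type*} [TopologicalSpace E] : IsRetract (univ : Set E) :=
  ⟨id, continuous_id, fun _ => mem_univ _, fun _ _ => rfl⟩

theorem isRetract_singleton {E : Type*} [TopologicalSpace E] (p : E) : IsRetract ({p} : Set E) :=
  ⟨fun _ => p, continuous_const, fun _ => rfl, fun _ hx => hx.symm⟩

/-- The identity of `T` factors through the identity of `E` as inclusion followed by retraction, and
the identity of `E` is nullhomotopic. -/
theorem IsRetract.contractibleSpace {E : Type*} [TopologicalSpace E] [ContractibleSpace E]
    {T : Set E} (hT : IsRetract T) : ContractibleSpace T := by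
  obtain ⟨r, hr, hrT, hid⟩ := hT
  rw [contractible_iff_id_nullhomotopic]
  have h := (((id_nullhomotopic E).comp_left
    (⟨Subtype.val, continuous_subtype_val⟩ : C(T, E))).comp_right
    (⟨fun x => ⟨r x, hrT x⟩, by fun_prop⟩ : C(E, T)))
  convert h using 1
  ext x
  simp [hid x x.2]

theorem IsRetract.isSimplyConnected {E : Type*} [TopologicalSpace E] [ContractibleSpace E]
    {T : Set E} (hT : IsRetract T) : IsSimplyConnected T := by
  have := hT.contractibleSpace
  exact (inferInstance : SimplyConnectedSpace T)

/-- Unicoherence: in a retract of a simply connected space, two connected closed sets that cover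
meet in a connected set. -/
theorem IsRetract.isPreconnected_inter {E : Type*} [TopologicalSpace E] [NormalSpace E]
    [SimplyConnectedSpace E] [LocallyPathConnectedSpace E] {T A B : Set E} (hT : IsRetract T)
    (hA : IsClosed A) (hB : IsClosed B) (hAc : IsPreconnected A) (hBc : IsPreconnected B)
    (hAB : A ∪ B = T) : IsPreconnected (A ∩ B) := by
  rw [isPreconnected_closed_iff]
  intro t t' ht ht' hcov ⟨p, hpAB, hpt⟩ ⟨q, hqAB, hqt⟩
  by_contra hne
  rw [not_nonempty_iff_eq_empty] at hne
  obtain ⟨r, hr, hrT, hid⟩ := hT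
  have hdisj : Disjoint (A ∩ B ∩ t) (A ∩ B ∩ t') := by
    rw [Set.disjoint_left]
    rintro x ⟨hx, hxt⟩ ⟨-, hxt'⟩
    exact (hne ▸ (⟨hx, hxt, hxt'⟩ : x ∈ A ∩ B ∩ (t ∩ t')) : x ∈ (∅ : Set E))
  obtain ⟨l, hl0, hl1, -⟩ := exists_continuous_zero_one_of_isClosed
    ((hA.inter hB).inter ht) ((hA.inter hB).inter ht') hdisj
  classical
  -- The two formulas agree on `A ∩ B`, where `l` is `0` or `1` and `exp (iπ) = exp (-iπ)`. A real
  -- lift of `g` would have to grow by `π` from `p` to `q` along `A` and drop by `π` along `B`.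
  let g : E → Circle := fun x =>
    if x ∈ A then Circle.exp (Real.pi * l x) else Circle.exp (-(Real.pi * l x))
  have hgA : ∀ x ∈ A, g x = Circle.exp (Real.pi * l x) := fun x hx => if_pos hx
  have hgB : ∀ x ∈ B, g x = Circle.exp (-(Real.pi * l x)) := by
    intro x hx
    by_cases hxA : x ∈ A
    · rw [hgA x hxA]
      rcases hcov ⟨hxA, hx⟩ with h | h
      · have : l x = 0 := hl0 ⟨⟨hxA, hx⟩, h⟩
        simp [this]
      · have : l x = 1 := hl1 ⟨⟨hxA, hx⟩, h⟩
        rw [this, mul_one, Circle.exp_eq_exp]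
        exact ⟨1, by push_cast; ring⟩
    · exact if_neg hxA
  have hgT : ContinuousOn g T := by
    rw [← hAB]
    refine ContinuousOn.union_of_isClosed ?_ ?_ hA hB
    · exact ContinuousOn.congr (by fun_prop) hgA
    · exact ContinuousOn.congr (by fun_prop) hgB
  -- The retraction extends `g` to the simply connected space `E`, where it lifts through
  -- `Circle.exp`.
  have hG : Continuous (g ∘ r) :=
    hgT.comp_continuous hr hrT
  obtain ⟨e₀, he₀⟩ := Circle.exp_surjective (g (r p)) 
  obtain ⟨φ, ⟨-, hφ⟩, -⟩ := Circle.isCoveringMap_exp.existsUnique_continuousMap_lifts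
    ⟨g ∘ r, hG⟩ p e₀ he₀
  have hφT : ∀ x ∈ T, Circle.exp (φ x) = g x := by
    intro x hx
    have := congrFun hφ x
    simpa [hid x hx] using this
  -- Two lifts of the same map differ by a multiple of `2π`, which is constant on a connected set.
  have hconst : ∀ (D : Set E) (s : E → ℝ), IsPreconnected D → Continuous s →
      (∀ x ∈ D, Circle.exp (φ x) = Circle.exp (s x)) → ∀ x ∈ D, ∀ y ∈ D, φ x - s x = φ y - s y := by
    intro D s hD hs h x hx y hy
    have hpi := Real.two_pi_pos
    have hmaps : ∀ z ∈ D, (φ z - s z) / (2 * Real.pi) ∈ range ((↑) : ℤ → ℝ) := by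
      intro z hz
      obtain ⟨m, hm⟩ := Circle.exp_eq_exp.1 (h z hz)
      refine ⟨m, ?_⟩
      rw [hm]
      field_simp
      ring
    have hcont : ContinuousOn (fun z => (φ z - s z) / (2 * Real.pi)) D := by fun_prop
    have := hD.constant_of_mapsTo Int.isClosedEmbedding_coe_real.isEmbedding.isDiscrete_range
      hcont hmaps hx hy
    field_simp at this
    linarith
  have hAT : A ⊆ T := hAB ▸ subset_union_left
  have hBT : B ⊆ T := hAB ▸ subset_union_right
  have h1 := hconst A (fun x => Real.pi * l x) hAc (by fun_prop)
    (fun x hx => (hφT x (hAT hx)).trans (hgA x hx)) p hpAB.1 q hqAB.1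
  have h2 := hconst B (fun x => -(Real.pi * l x)) hBc (by fun_prop)
    (fun x hx => (hφT x (hBT hx)).trans (hgB x hx)) p hpAB.2 q hqAB.2
  have hp0 : l p = 0 := hl0 ⟨hpAB, hpt⟩
  have hq1 : l q = 1 := hl1 ⟨hqAB, hqt⟩
  simp only [hp0, hq1] at h1 h2
  linarith [Real.pi_pos]

/-- Removing a component of the complement of a connected set does not disconnect. -/
theorem IsPreconnected.diff_component {E : Type*} [TopologicalSpace E] {U T Z : Set E}
    (hU : IsPreconnected U) (hTU : T ⊆ U) (hT : IsPreconnected T) (hZ : IsPreconnected Z)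
    (hZU : Z ⊆ U \ T)
    (hmax : ∀ W, IsPreconnected W → W ⊆ U \ T → Z ⊆ W → W ⊆ Z) : IsPreconnected (U \ Z) := by
  have key : ∀ t t' : Set E, IsClosed t → IsClosed t' → U \ Z ⊆ t ∪ t' →
      U \ Z ∩ (t ∩ t') = ∅ → T ⊆ t → U \ Z ⊆ t := by
    intro t t' ht ht' hcov hdis hTt
    have hTZ : ∀ x ∈ T, x ∉ Z := fun x hx hxZ => (hZU hxZ).2 hx
    have hdis' : ∀ x, x ∈ U → x ∉ Z → x ∈ t → x ∈ t' → False := fun x h1 h2 h3 h4 =>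
      (hdis ▸ (⟨⟨h1, h2⟩, h3, h4⟩ : x ∈ U \ Z ∩ (t ∩ t')) : x ∈ (∅ : Set E))
    -- `N` is the half of a separation that misses `T`. The set `Z ∪ N` is connected, since a
    -- separation of it would give one of `U`; by maximality of `Z`, the half `N` is empty.
    set N := (U \ Z) ∩ t' with hN
    have hpre : IsPreconnected (Z ∪ N) := by
      have aux : ∀ s s' : Set E, IsClosed s → IsClosed s' → Z ∪ N ⊆ s ∪ s' →
          (Z ∪ N) ∩ (s ∩ s') = ∅ → Z ⊆ s → Z ∪ N ⊆ s ∨ Z ∪ N ⊆ s' := by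
        intro s s' hs hs' hc hd hZs
        have hd' : ∀ x, x ∈ Z ∪ N → x ∈ s → x ∈ s' → False := fun x h1 h2 h3 =>
          (hd ▸ (⟨h1, h2, h3⟩ : x ∈ (Z ∪ N) ∩ (s ∩ s')) : x ∈ (∅ : Set E))
        have hor : U ⊆ t ∪ s ∨ U ⊆ t' ∩ s' := by
          refine isPreconnected_iff_subset_of_disjoint_closed.1 hU (t ∪ s) (t' ∩ s')
            (ht.union hs) (ht'.inter hs') ?_ ?_
          · intro x hx
            by_cases hxZ : x ∈ Z
            · exact Or.inl (Or.inr (hZs hxZ))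
            · rcases hcov ⟨hx, hxZ⟩ with h | h
              · exact Or.inl (Or.inl h)
              · rcases hc (Or.inr ⟨⟨hx, hxZ⟩, h⟩) with h' | h'
                · exact Or.inl (Or.inr h')
                · exact Or.inr ⟨h, h'⟩
          · rw [Set.eq_empty_iff_forall_notMem]
            rintro x ⟨hxU, hx, hxt', hxs'⟩
            by_cases hxZ : x ∈ Z
            · exact hd' x (Or.inl hxZ) (hZs hxZ) hxs'
            · rcases hx with hx | hx
              · exact hdis' x hxU hxZ hx hxt'
              · exact hd' x (Or.inr ⟨⟨hxU, hxZ⟩, hxt'⟩) hx hxs'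
        rcases hor with h | h
        · left
          rintro x (hx | hx)
          · exact hZs hx
          · rcases h hx.1.1 with h | h
            · exact (hdis' x hx.1.1 hx.1.2 h hx.2).elim
            · exact h
        · right
          rintro x (hx | hx)
          · exact (h (hZU hx).1).2
          · exact (h hx.1.1).2
      rw [isPreconnected_iff_subset_of_disjoint_closed]
      intro s s' hs hs' hc hd
      have hd2 : Z ∩ (s ∩ s') = ∅ :=
        subset_empty_iff.1 (hd ▸ inter_subset_inter_left _ subset_union_left)
      rcases isPreconnected_iff_subset_of_disjoint_closed.1 hZ s s' hs hs'
        (subset_union_left.trans hc) hd2 with h | h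
      · exact aux s s' hs hs' hc hd h
      · exact (aux s' s hs' hs (union_comm s s' ▸ hc) (inter_comm s s' ▸ hd) h).symm
    have hsub := hmax (Z ∪ N) hpre ?_ subset_union_left
    · intro x hx
      rcases hcov hx with h | h
      · exact h
      · exact (hx.2 (hsub (Or.inr ⟨hx, h⟩))).elim
    · rintro x (hx | hx)
      · exact hZU hx
      · exact ⟨hx.1.1, fun hxT => hdis' x hx.1.1 hx.1.2 (hTt hxT) hx.2⟩
  rw [isPreconnected_iff_subset_of_disjoint_closed]
  intro t t' ht ht' hcov hdis
  have hTUZ : T ⊆ U \ Z := fun x hx => ⟨hTU hx, fun h => (hZU h).2 hx⟩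
  rcases isPreconnected_iff_subset_of_disjoint_closed.1 hT t t' ht ht' (hTUZ.trans hcov)
    (subset_empty_iff.1 (hdis ▸ inter_subset_inter_left _ hTUZ)) with h | h
  · exact Or.inl (key t t' ht ht' hcov hdis h)
  · exact Or.inr (key t' t ht' ht (union_comm t t' ▸ hcov) (inter_comm t t' ▸ hdis) h)

/-- Collapsing finitely many closed pieces of a retract onto retracts `K i` leaves a retract. -/
theorem IsRetract.collapse {E ι : Type*} [TopologicalSpace E] [Finite ι] {T T' : Set E}
    {A K : ι → Set E} (hT : IsRetract T) (hT' : IsClosed T') (hA : ∀ i, IsClosed (A i))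
    (hcov : T = T' ∪ ⋃ i, A i) (hK : ∀ i, IsRetract (K i)) (hKT : ∀ i, K i ⊆ T')
    (hAT : ∀ i, A i ∩ T' ⊆ K i) (hAA : ∀ i j, i ≠ j → A i ∩ A j ⊆ K i) : IsRetract T' := by
  classical
  obtain ⟨r, hr, hrT, hid⟩ := hT
  choose ρ hρ hρK hρid using hK
  let f : E → E := fun p => if h : p ∉ T' ∧ ∃ i, p ∈ A i then ρ h.2.choose p else p
  have hfT' : ∀ p ∈ T', f p = p := fun p hp => dif_neg fun h => h.1 hp
  have hfA : ∀ i, ∀ p ∈ A i, f p = ρ i p := by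
    intro i p hp
    by_cases hpT : p ∈ T'
    · rw [hfT' p hpT, hρid i p (hAT i ⟨hp, hpT⟩)]
    · have h : p ∉ T' ∧ ∃ i, p ∈ A i := ⟨hpT, i, hp⟩
      have hj := h.2.choose_spec
      have : h.2.choose = i := by
        by_contra hne
        exact hpT (hKT _ (hAA _ _ hne ⟨hj, hp⟩))
      simp only [f, dif_pos h, this]
  have hfT : ContinuousOn f T := by
    rw [hcov]
    refine ContinuousOn.union_of_isClosed (continuousOn_id.congr hfT') ?_ hT'
      (isClosed_iUnion_of_finite hA)
    exact (locallyFinite_of_finite A).continuousOn_iUnion hA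
      fun i => (hρ i).continuousOn.congr (hfA i)
  refine ⟨f ∘ r, hfT.comp_continuous hr hrT, fun x => ?_, fun x hx => ?_⟩
  · have := hrT x
    rw [hcov] at this
    rcases this with h | h
    · simpa [hfT' _ h] using h
    · obtain ⟨i, hi⟩ := mem_iUnion.1 h
      simpa [hfA i _ hi] using hKT i (hρK i _)
  · simp [hid x (hcov ▸ Or.inl hx), hfT' x hx]

/-! ### Components of open sets, in general and on the line -/

/-- `U` is a connected component of the set `R`. -/
def IsComponentOf {E : Type*} [TopologicalSpace E] (U R : Set E) : Prop :=
  ∃ x ∈ R, U = connectedComponentIn R x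

namespace IsComponentOf

variable {E : Type*} [TopologicalSpace E] {U V R W : Set E}

theorem of_mem {x : E} (hx : x ∈ R) : IsComponentOf (connectedComponentIn R x) R := ⟨x, hx, rfl⟩

theorem subset (h : IsComponentOf U R) : U ⊆ R := by
  obtain ⟨x, -, rfl⟩ := h
  exact connectedComponentIn_subset R x

theorem isConnected (h : IsComponentOf U R) : IsConnected U := by
  obtain ⟨x, hx, rfl⟩ := h
  exact isConnected_connectedComponentIn_iff.2 hx

theorem isPreconnected (h : IsComponentOf U R) : IsPreconnected U := h.isConnected.isPreconnected

theorem nonempty (h : IsComponentOf U R) : U.Nonempty := h.isConnected.nonempty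

theorem eq_of_mem (h : IsComponentOf U R) {x : E} (hx : x ∈ U) :
    U = connectedComponentIn R x := by
  obtain ⟨y, -, rfl⟩ := h
  exact connectedComponentIn_eq hx

theorem subset_of_inter (h : IsComponentOf U R) (hW : IsPreconnected W) (hWR : W ⊆ R)
    (hne : (W ∩ U).Nonempty) : W ⊆ U := by
  obtain ⟨x, hxW, hxU⟩ := hne
  rw [h.eq_of_mem hxU]
  exact hW.subset_connectedComponentIn hxW hWR

theorem eq_of_inter (hU : IsComponentOf U R) (hV : IsComponentOf V R)
    (hne : (U ∩ V).Nonempty) : U = V := by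
  obtain ⟨x, hxU, hxV⟩ := hne
  rw [hU.eq_of_mem hxU, hV.eq_of_mem hxV]

theorem disjoint (hU : IsComponentOf U R) (hV : IsComponentOf V R) (hne : U ≠ V) :
    Disjoint U V := by
  rw [Set.disjoint_iff_inter_eq_empty, ← not_nonempty_iff_eq_empty]
  exact fun h => hne (hU.eq_of_inter hV h)

theorem isOpen [LocallyConnectedSpace E] (h : IsComponentOf U R) (hR : IsOpen R) : IsOpen U := by
  obtain ⟨x, -, rfl⟩ := h
  exact hR.connectedComponentIn

/-- A point of `R` has an open component of `R` around it, which meets `U` as soon as the point is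
adherent to `U`. -/
theorem closure_inter [LocallyConnectedSpace E] (h : IsComponentOf U R) (hR : IsOpen R) :
    closure U ∩ R ⊆ U := by
  rintro x ⟨hxU, hxR⟩
  have hc := of_mem hxR
  obtain ⟨y, hy, hyU⟩ := mem_closure_iff.1 hxU _ (hc.isOpen hR) (mem_connectedComponentIn hxR)
  rw [h.eq_of_inter hc ⟨y, hyU, hy⟩]
  exact mem_connectedComponentIn hxR

theorem frontier_subset [LocallyConnectedSpace E] (h : IsComponentOf U R) (hR : IsOpen R) :
    frontier U ⊆ frontier R := by
  intro x hx
  rw [(h.isOpen hR).frontier_eq] at hx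
  rw [hR.frontier_eq]
  exact ⟨closure_mono h.subset hx.1, fun hxR => hx.2 (h.closure_inter hR ⟨hx.1, hxR⟩)⟩

theorem exists_mem {x : E} (hx : x ∈ R) : ∃ U, IsComponentOf U R ∧ x ∈ U :=
  ⟨_, of_mem hx, mem_connectedComponentIn hx⟩

end IsComponentOf

/-- A nonempty open connected subset of the line is an open interval, bounded or not. -/
theorem IsPreconnected.eq_open_interval {I : Set ℝ} (hI : IsPreconnected I) (ho : IsOpen I)
    (hne : I.Nonempty) :
    I = univ ∨ (∃ a, I = Ioi a ∨ I = Iio a) ∨ ∃ a b, a < b ∧ I = Ioo a b := by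
  have h := hI.mem_intervals
  rw [← ho.interior_eq] at h ⊢
  have hne' := ho.interior_eq ▸ hne
  set a := sInf (interior I)
  set b := sSup (interior I)
  have key : interior I = Ioo a b → a < b := by
    intro h
    rw [ho.interior_eq] at hne'
    rw [← ho.interior_eq, h, nonempty_Ioo] at hne
    exact hne
  -- The ten shapes in `mem_intervals` include closed and half-open ones; taking interiors on both
  -- sides turns these into open intervals.
  have hint : ∀ J, interior I = J → interior I = interior J := by
    intro J hJ
    rw [← hJ, interior_interior]
  simp only [mem_insert_iff, mem_singleton_iff] at h
  rcases h with h | h | h | h | h | h | h | h | h | h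
  · have := hint _ h; rw [interior_Icc] at this
    exact Or.inr (Or.inr ⟨a, b, key this, this⟩)
  · have := hint _ h; rw [interior_Ico] at this
    exact Or.inr (Or.inr ⟨a, b, key this, this⟩)
  · have := hint _ h; rw [interior_Ioc] at this
    exact Or.inr (Or.inr ⟨a, b, key this, this⟩)
  · exact Or.inr (Or.inr ⟨a, b, key h, h⟩)
  · have := hint _ h; rw [interior_Ici] at this
    exact Or.inr (Or.inl ⟨a, Or.inl this⟩)
  · exact Or.inr (Or.inl ⟨a, Or.inl h⟩)
  · have := hint _ h; rw [interior_Iic] at this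
    exact Or.inr (Or.inl ⟨b, Or.inr this⟩)
  · exact Or.inr (Or.inl ⟨b, Or.inr h⟩)
  · exact Or.inl h
  · rw [h] at hne'
    exact (not_nonempty_empty hne').elim

/-- An open subset of the line with finite frontier has finitely many components. -/
theorem IsOpen.finite_components_of_frontier {O : Set ℝ} (hO : IsOpen O)
    (hfin : (frontier O).Finite) : {I | IsComponentOf I O}.Finite := by
  -- A component is determined by its shape and its end points, and the latter belong to the finite
  -- frontier of `O`.
  refine (((finite_singleton (univ : Set ℝ)).union ((hfin.image Ioi).union (hfin.image Iio))).union
    ((hfin.prod hfin).image fun p => Ioo p.1 p.2)).subset fun I hI => ?_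
  have hIopen : IsOpen I := IsComponentOf.isOpen hI hO
  have hfr : frontier I ⊆ frontier O := IsComponentOf.frontier_subset hI hO
  rcases hI.isPreconnected.eq_open_interval hIopen hI.nonempty with h | ⟨a, h | h⟩ | ⟨a, b, hab, h⟩
  · exact Or.inl (Or.inl h)
  · refine Or.inl (Or.inr (Or.inl ⟨a, hfr ?_, h.symm⟩))
    simp [h]
  · refine Or.inl (Or.inr (Or.inr ⟨a, hfr ?_, h.symm⟩))
    simp [h]
  · refine Or.inr ⟨(a, b), ⟨hfr ?_, hfr ?_⟩, h.symm⟩ <;> simp [h, frontier_Ioo hab]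

/-! ### Arrangements of properly embedded lines in the plane -/

/-- Punctured balls of the plane are connected. -/
theorem isPreconnected_ball_diff_singleton (p : Plane) {r : ℝ} (hr : 0 < r) :
    IsPreconnected (Metric.ball p r \ {p}) := by
  have h1 : IsPreconnected ({0}ᶜ : Set Plane) :=
    (isConnected_compl_singleton_of_one_lt_rank (by
      rw [← Module.finrank_eq_rank]; simp) (0 : Plane)).isPreconnected
  have h2 : (OpenPartialHomeomorph.univBall p r) '' ({0}ᶜ) = Metric.ball p r \ {p} := by
    have hs : (OpenPartialHomeomorph.univBall p r).source = univ :=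
      OpenPartialHomeomorph.univBall_source p r
    have ht := OpenPartialHomeomorph.univBall_target p hr
    have h0 : OpenPartialHomeomorph.univBall p r 0 = p := OpenPartialHomeomorph.univBall_apply_zero p r
    have hinj : Function.Injective (OpenPartialHomeomorph.univBall p r) := by
      have := (OpenPartialHomeomorph.univBall p r).injOn
      rwa [hs, injOn_univ] at this
    rw [image_compl_eq_range_sdiff_image hinj, image_singleton, h0, ← image_univ, ← hs,
      (OpenPartialHomeomorph.univBall p r).image_source_eq_target, ht]
  rw [← h2]
  exact h1.image _ (OpenPartialHomeomorph.continuous_univBall p r).continuousOn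

/-- If a nonempty open set `U` of the plane equals the interior of its closure, deleting a finite
set from its frontier leaves a dense subset of the frontier. -/
theorem frontier_subset_closure_diff_finite {U S : Set Plane} (hU : IsOpen U)
    (hreg : interior (closure U) = U) (hS : S.Finite) :
    frontier U ⊆ closure (frontier U \ S) := by
  intro p hp
  by_contra hcl
  -- Otherwise `p` is an isolated frontier point. A small punctured ball around it is connected,
  -- meets `U` and misses the frontier, so it lies in `U`; then `p` is interior to `closure U`, that
  -- is, in `U`.
  have h1 : (closure (frontier U \ S) ∪ (S \ {p}))ᶜ ∈ 𝓝 p := by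
    refine IsOpen.mem_nhds ?_ ?_
    · exact (isClosed_closure.union (hS.sdiff).isClosed).isOpen_compl
    · rintro (h | h)
      · exact hcl h
      · exact h.2 rfl
  obtain ⟨r, hr, hball⟩ := Metric.mem_nhds_iff.1 h1
  have hmiss : ∀ x ∈ Metric.ball p r \ {p}, x ∉ frontier U := by
    rintro x ⟨hx, hxp⟩ hxf
    refine hball hx ?_
    by_cases hxS : x ∈ S
    · exact Or.inr ⟨hxS, hxp⟩
    · exact Or.inl (subset_closure ⟨hxf, hxS⟩)
  rw [hU.frontier_eq] at hp hmiss
  have hsub : Metric.ball p r \ {p} ⊆ U := by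
    refine (isPreconnected_ball_diff_singleton p hr).subset_of_closure_inter_subset hU ?_ ?_
    · obtain ⟨y, hy, hyU⟩ := mem_closure_iff.1 hp.1 _ Metric.isOpen_ball (Metric.mem_ball_self hr)
      exact ⟨y, ⟨hy, fun h => hp.2 (h ▸ hyU)⟩, hyU⟩
    · rintro x ⟨hxc, hx⟩
      by_contra hxU
      exact hmiss x hx ⟨hxc, hxU⟩
  apply hp.2
  rw [← hreg]
  refine mem_interior.2 ⟨Metric.ball p r, fun x hx => ?_, Metric.isOpen_ball, Metric.mem_ball_self hr⟩
  by_cases hxp : x = p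
  · exact hxp ▸ hp.1
  · exact subset_closure (hsub ⟨hx, hxp⟩)

/-- The properly embedded line which a chart of the plane carries to the horizontal axis. -/
def chartAxis (φ : Plane ≃ₜ ℝ × ℝ) : Set Plane := {p | (φ p).2 = 0}

theorem isClosed_chartAxis (φ : Plane ≃ₜ ℝ × ℝ) : IsClosed (chartAxis φ) :=
  isClosed_eq (by fun_prop) continuous_const

theorem mem_chartAxis_iff {φ : Plane ≃ₜ ℝ × ℝ} {p : Plane} :
    p ∈ chartAxis φ ↔ p = φ.symm ((φ p).1, 0) := by
  constructor
  · intro h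
    rw [Homeomorph.eq_symm_apply]
    exact Prod.ext rfl h
  · intro h
    rw [h]
    simp [chartAxis]

section Arrangement

variable {ι : Type*} (Φ : ι → Plane ≃ₜ ℝ × ℝ) (s : Finset ι)

/-- The complement of an arrangement of lines. -/
def arrangementCompl : Set Plane := {p | ∀ i ∈ s, p ∉ chartAxis (Φ i)}

/-- The points that lie on two lines of an arrangement. -/
def arrangementCrossings : Set Plane :=
  {p | ∃ i ∈ s, ∃ j ∈ s, i ≠ j ∧ p ∈ chartAxis (Φ i) ∩ chartAxis (Φ j)}

theorem isOpen_arrangementCompl : IsOpen (arrangementCompl Φ s) := by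
  have : arrangementCompl Φ s = ⋂ i ∈ s, (chartAxis (Φ i))ᶜ := by
    ext p; simp [arrangementCompl]
  rw [this]
  exact isOpen_biInter_finset fun i _ => (isClosed_chartAxis _).isOpen_compl

theorem finite_arrangementCrossings
    (hfin : ∀ i ∈ s, ∀ j ∈ s, i ≠ j → (chartAxis (Φ i) ∩ chartAxis (Φ j)).Finite) :
    (arrangementCrossings Φ s).Finite := by
  have : arrangementCrossings Φ s ⊆ ⋃ i ∈ s, ⋃ j ∈ s, ⋃ (_ : i ≠ j),
      chartAxis (Φ i) ∩ chartAxis (Φ j) := by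
    rintro p ⟨i, hi, j, hj, hij, hp⟩
    simp only [mem_iUnion]
    exact ⟨i, hi, j, hj, hij, hp⟩
  refine Finite.subset ?_ this
  refine s.finite_toSet.biUnion fun i hi => s.finite_toSet.biUnion fun j hj => ?_
  exact finite_iUnion fun hij => hfin i hi j hj hij

variable {Φ s}

/-- Near a point of exactly one line, the complement of the arrangement has two sides. -/
theorem exists_local_sides {i : ι} {p : Plane} (hp : p ∈ chartAxis (Φ i))
    (hj : ∀ j ∈ s, j ≠ i → p ∉ chartAxis (Φ j)) :
    ∃ N P M : Set Plane, IsOpen N ∧ p ∈ N ∧ IsConnected P ∧ IsConnected M ∧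
      P ⊆ arrangementCompl Φ s ∧ M ⊆ arrangementCompl Φ s ∧ N ⊆ P ∪ M ∪ chartAxis (Φ i) ∧
      N ∩ chartAxis (Φ i) ⊆ closure P ∧ N ∩ chartAxis (Φ i) ⊆ closure M := by
  obtain ⟨φ, hφ⟩ : ∃ φ, φ = Φ i := ⟨_, rfl⟩
  rw [← hφ] at hp ⊢
  have hO : IsOpen {p | ∀ j ∈ s, j ≠ i → p ∉ chartAxis (Φ j)} := by
    have : {p | ∀ j ∈ s, j ≠ i → p ∉ chartAxis (Φ j)} =
        ⋂ j ∈ s, ⋂ (_ : j ≠ i), (chartAxis (Φ j))ᶜ := by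
      ext p; simp
    rw [this]
    exact isOpen_biInter_finset fun j _ => isOpen_iInter_of_finite
      fun _ => (isClosed_chartAxis _).isOpen_compl
  have hO' := hO.preimage φ.symm.continuous
  have hmem : φ p ∈ φ.symm ⁻¹' {p | ∀ j ∈ s, j ≠ i → p ∉ chartAxis (Φ j)} := by
    simpa using hj
  obtain ⟨ε, hε, hball⟩ := Metric.isOpen_iff.1 hO' _ hmem
  have hp0 : (φ p).2 = 0 := hp
  -- The metric of `ℝ × ℝ` is the sup metric: the ball is a box centred on the axis, and the two
  -- sides are its open upper and lower halves.
  have hprod : Metric.ball (φ p) ε = Metric.ball (φ p).1 ε ×ˢ Ioo (-ε) ε := by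
    rw [← Prod.mk.eta (p := φ p), ← ball_prod_same, hp0, Real.ball_eq_Ioo 0]
    simp
  have hkey : ∀ J : Set ℝ, J ⊆ Ioo (-ε) ε → 0 ∉ J → IsConnected J → 0 ∈ closure J →
      IsConnected (φ ⁻¹' (Metric.ball (φ p).1 ε ×ˢ J)) ∧
      φ ⁻¹' (Metric.ball (φ p).1 ε ×ˢ J) ⊆ arrangementCompl Φ s ∧
      φ ⁻¹' (Metric.ball (φ p) ε) ∩ chartAxis φ ⊆
        closure (φ ⁻¹' (Metric.ball (φ p).1 ε ×ˢ J)) := by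
    intro J hJ h0 hc hcl
    refine ⟨?_, ?_, ?_⟩
    · rw [← φ.image_symm]
      exact (((Metric.isConnected_ball hε).prod hc)).image _ φ.symm.continuous.continuousOn
    · rintro q ⟨hq1, hq2⟩ j hjs
      by_cases hji : j = i
      · subst hji
        rw [← hφ]
        intro h
        exact h0 ((show (φ q).2 = 0 from h) ▸ hq2)
      · have : φ q ∈ Metric.ball (φ p) ε := hprod ▸ ⟨hq1, hJ hq2⟩
        simpa using hball this j hjs hji
    · rintro q ⟨hq, hq0⟩
      rw [← φ.preimage_closure, closure_prod_eq]
      rw [hprod] at hq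
      refine ⟨subset_closure hq.1, ?_⟩
      rw [show (φ q).2 = 0 from hq0]
      exact hcl
  have hP := hkey (Ioo 0 ε) (Ioo_subset_Ioo_left (by linarith)) (by simp) (isConnected_Ioo hε)
    (by rw [closure_Ioo hε.ne]; simp [hε.le])
  have hM := hkey (Ioo (-ε) 0) (Ioo_subset_Ioo_right hε.le) (by simp)
    (isConnected_Ioo (by linarith))
    (by rw [closure_Ioo (by linarith)]; simp [hε.le])
  refine ⟨φ ⁻¹' Metric.ball (φ p) ε, _, _, Metric.isOpen_ball.preimage φ.continuous,
    Metric.mem_ball_self hε, hP.1, hM.1, hP.2.1, hM.2.1, ?_, hP.2.2, hM.2.2⟩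
  intro q hq
  have hq' : φ q ∈ Metric.ball (φ p).1 ε ×ˢ Ioo (-ε) ε := hprod ▸ hq
  rcases lt_trichotomy (φ q).2 0 with h | h | h
  · exact Or.inl (Or.inr ⟨hq'.1, hq'.2.1, h⟩)
  · exact Or.inr h
  · exact Or.inl (Or.inl ⟨hq'.1, h, hq'.2.2⟩)

variable {U : Set Plane}

/-- Components of the complement of an arrangement are regular open sets. -/
theorem interior_closure_arrangement (hU : IsComponentOf U (arrangementCompl Φ s)) :
    interior (closure U) = U := by
  have hR := isOpen_arrangementCompl Φ s
  refine subset_antisymm (fun p hp => ?_) ((hU.isOpen hR).subset_interior_closure)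
  by_contra hpU
  have hpR : p ∉ arrangementCompl Φ s := fun h =>
    hpU (hU.closure_inter hR ⟨interior_subset hp, h⟩)
  simp only [arrangementCompl, mem_ofPred_eq, not_forall, not_not] at hpR
  obtain ⟨i, his, hpi⟩ := hpR
  obtain ⟨φ, hφ⟩ : ∃ φ, φ = Φ i := ⟨_, rfl⟩
  have hne : ∀ q ∈ U, (φ q).2 ≠ 0 := fun q hq => hφ ▸ hU.subset hq i his
  have hop := isOpen_interior.preimage φ.symm.continuous (t := interior (closure U))
  have hmem : φ p ∈ φ.symm ⁻¹' interior (closure U) := by simpa using hp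
  obtain ⟨ε, hε, hball⟩ := Metric.isOpen_iff.1 hop _ hmem
  have hp0 : (φ p).2 = 0 := hφ ▸ hpi
  have hpt : ∀ t : ℝ, |t| < ε → φ.symm ((φ p).1, t) ∈ closure U := fun t ht => by
    refine interior_subset (hball ?_)
    rw [← Prod.mk.eta (p := φ p), ← ball_prod_same, hp0]
    exact ⟨Metric.mem_ball_self hε, by simpa using ht⟩
  have hcont : Continuous fun q => (φ q).2 := by fun_prop
  have hclosed : ∀ J : Set ℝ, IsClosed J → (∀ q ∈ U, (φ q).2 ∈ J) →
      ∀ q ∈ closure U, (φ q).2 ∈ J := fun J hJ h q hq =>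
    closure_minimal h (hJ.preimage hcont) hq
  have h2 : |ε / 2| < ε := by rw [abs_of_pos (by linarith)]; linarith
  have h3 : |-(ε / 2)| < ε := by rwa [abs_neg]
  -- Being connected and off the line, `U` stays strictly on one side of it, but `closure U`
  -- contains points on both sides near `p`.
  rcases isPreconnected_iff_subset_of_disjoint.1 hU.isPreconnected {q | 0 < (φ q).2}
    {q | (φ q).2 < 0} (isOpen_lt continuous_const hcont) (isOpen_lt hcont continuous_const)
    (fun q hq => (hne q hq).lt_or_gt.symm) (by
      ext q; simp only [mem_inter_iff, mem_ofPred_eq, mem_empty_iff_false, iff_false]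
      rintro ⟨-, h1, h2⟩; linarith) with h | h
  · have := hclosed (Ici 0) isClosed_Ici (fun q hq => mem_Ici.2 (le_of_lt (h hq))) _ (hpt _ h3)
    simp at this
    linarith
  · have := hclosed (Iic 0) isClosed_Iic (fun q hq => mem_Iic.2 (le_of_lt (h hq))) _ (hpt _ h2)
    simp at this
    linarith

/-- A frontier point off the crossings lies on exactly one line. -/
theorem exists_unique_axis (hU : IsComponentOf U (arrangementCompl Φ s)) {p : Plane}
    (hp : p ∈ frontier U) (hpS : p ∉ arrangementCrossings Φ s) :
    ∃ i ∈ s, p ∈ chartAxis (Φ i) ∧ ∀ j ∈ s, j ≠ i → p ∉ chartAxis (Φ j) := by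
  have hR := isOpen_arrangementCompl Φ s
  have hpR : p ∉ arrangementCompl Φ s := by
    have := hU.frontier_subset hR hp
    rw [hR.frontier_eq] at this
    exact this.2
  simp only [arrangementCompl, mem_ofPred_eq, not_forall, not_not] at hpR
  obtain ⟨i, his, hpi⟩ := hpR
  exact ⟨i, his, hpi, fun j hj hji h => hpS ⟨i, his, j, hj, hji.symm, hpi, h⟩⟩

/-- The parameters at which a line of the arrangement meets no other line. -/
def freeParams (Φ : ι → Plane ≃ₜ ℝ × ℝ) (s : Finset ι) (i : ι) : Set ℝ :=
  {u | ∀ j ∈ s, j ≠ i → (Φ i).symm (u, 0) ∉ chartAxis (Φ j)}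

/-- The part of the line of a chart that lies over `I`. -/
def chartArc (φ : Plane ≃ₜ ℝ × ℝ) (I : Set ℝ) : Set Plane :=
  {p | p ∈ chartAxis φ ∧ (φ p).1 ∈ I}

theorem symm_mem_chartAxis (φ : Plane ≃ₜ ℝ × ℝ) (u : ℝ) : φ.symm (u, 0) ∈ chartAxis φ := by
  simp [chartAxis]

theorem closure_chartArc (φ : Plane ≃ₜ ℝ × ℝ) (I : Set ℝ) :
    closure (chartArc φ I) = chartArc φ (closure I) := by
  have h : ∀ J : Set ℝ, chartArc φ J = φ ⁻¹' (J ×ˢ {0}) := fun J => by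
    ext p; simp [chartArc, chartAxis, and_comm]
  rw [h, h, ← φ.preimage_closure, closure_prod_eq, closure_singleton]

theorem isOpen_freeParams (i : ι) : IsOpen (freeParams Φ s i) := by
  have : freeParams Φ s i =
      ⋂ j ∈ s, ⋂ (_ : j ≠ i), (fun u : ℝ => (Φ i).symm (u, 0)) ⁻¹' (chartAxis (Φ j))ᶜ := by
    ext p; simp [freeParams]
  rw [this]
  exact isOpen_biInter_finset fun j _ => isOpen_iInter_of_finite
    fun _ => (isClosed_chartAxis _).isOpen_compl.preimage (by fun_prop)

/-- Frontier points of `freeParams` are parameters of crossings. -/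
theorem finite_components_freeParams
    (hS : (arrangementCrossings Φ s).Finite) {i : ι} (hi : i ∈ s) :
    {I | IsComponentOf I (freeParams Φ s i)}.Finite := by
  refine (isOpen_freeParams i).finite_components_of_frontier ?_
  rw [(isOpen_freeParams i).frontier_eq]
  refine (hS.image fun p => (Φ i p).1).subset ?_
  rintro u ⟨-, hu⟩
  simp only [freeParams, mem_ofPred_eq, not_forall, not_not] at hu
  obtain ⟨j, hj, hji, h⟩ := hu
  exact ⟨(Φ i).symm (u, 0), ⟨i, hi, j, hj, hji.symm, symm_mem_chartAxis _ _, h⟩, by simp⟩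

/-- A connected piece of a line that avoids the other lines and meets the closure of a component is
contained in this closure. -/
theorem chartArc_subset_closure (hU : IsComponentOf U (arrangementCompl Φ s)) {i : ι}
    (hi : i ∈ s) {I : Set ℝ} (hI : IsPreconnected I) (hIf : I ⊆ freeParams Φ s i)
    (hne : (chartArc (Φ i) I ∩ closure U).Nonempty) : chartArc (Φ i) I ⊆ closure U := by
  set J : Set ℝ := {u | (Φ i).symm (u, 0) ∈ closure U} with hJ
  have hJc : IsClosed J := isClosed_closure.preimage
    (show Continuous fun u : ℝ => (Φ i).symm (u, 0) by fun_prop)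
  -- `J` is closed, and it is open along `I`: near a point of a single line `U` contains a whole
  -- local side, whose closure contains the line nearby.
  have hstep : J ∩ I ⊆ interior J := by
    rintro u ⟨huJ, huI⟩
    obtain ⟨N, P, M, hN, hpN, hP, hM, hPR, hMR, hNs, hNP, hNM⟩ :=
      exists_local_sides (s := s) (symm_mem_chartAxis (Φ i) u) (hIf huI)
    have hin : N ∩ chartAxis (Φ i) ⊆ closure U := by
      obtain ⟨y, hyN, hyU⟩ := mem_closure_iff.1 huJ N hN hpN
      rcases hNs hyN with (h | h) | h
      · exact hNP.trans (closure_mono (hU.subset_of_inter hP.isPreconnected hPR ⟨y, h, hyU⟩))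
      · exact hNM.trans (closure_mono (hU.subset_of_inter hM.isPreconnected hMR ⟨y, h, hyU⟩))
      · exact (hU.subset hyU i hi h).elim
    refine mem_interior.2 ⟨(fun u : ℝ => (Φ i).symm (u, 0)) ⁻¹' N, fun v hv =>
      hin ⟨hv, symm_mem_chartAxis _ _⟩, hN.preimage (by fun_prop), hpN⟩
  have hIJ : I ⊆ interior J := by
    refine hI.subset_of_closure_inter_subset isOpen_interior ?_ ?_
    · obtain ⟨p, ⟨hp, hpI⟩, hpU⟩ := hne
      exact ⟨_, hpI, hstep ⟨by rw [hJ, mem_ofPred_eq, ← mem_chartAxis_iff.1 hp]; exact hpU, hpI⟩⟩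
    · rintro u ⟨hu, huI⟩
      exact hstep ⟨closure_minimal interior_subset hJc hu, huI⟩
  rintro p ⟨hp, hpI⟩
  rw [mem_chartAxis_iff.1 hp]
  exact (interior_subset (hIJ hpI) : _ ∈ J)

/-- Every frontier point off the crossings lies on an arc contained in the frontier. -/
theorem exists_arc_of_frontier (hU : IsComponentOf U (arrangementCompl Φ s)) {p : Plane}
    (hp : p ∈ frontier U) (hpS : p ∉ arrangementCrossings Φ s) :
    ∃ i ∈ s, ∃ I, IsComponentOf I (freeParams Φ s i) ∧ p ∈ chartArc (Φ i) I ∧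
      chartArc (Φ i) I ⊆ closure U := by
  obtain ⟨i, hi, hpi, hj⟩ := exists_unique_axis hU hp hpS
  have hmem : (Φ i p).1 ∈ freeParams Φ s i := by
    intro j hjs hji
    rw [← mem_chartAxis_iff.1 hpi]
    exact hj j hjs hji
  obtain ⟨I, hI, hpI⟩ := IsComponentOf.exists_mem hmem
  exact ⟨i, hi, I, hI, ⟨hpi, hpI⟩, chartArc_subset_closure hU hi hI.isPreconnected hI.subset
    ⟨p, ⟨hpi, hpI⟩, frontier_subset_closure hp⟩⟩

/-- The arcs into which the crossings cut the lines of an arrangement, with their end points. -/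
def arrangementArcs (Φ : ι → Plane ≃ₜ ℝ × ℝ) (s : Finset ι) : Set (Set Plane) :=
  {A | ∃ i ∈ s, ∃ I, IsComponentOf I (freeParams Φ s i) ∧ A = chartArc (Φ i) (closure I)}

theorem finite_arrangementArcs (hS : (arrangementCrossings Φ s).Finite) :
    (arrangementArcs Φ s).Finite := by
  have : arrangementArcs Φ s ⊆ ⋃ i ∈ s, (fun I => chartArc (Φ i) (closure I)) ''
      {I | IsComponentOf I (freeParams Φ s i)} := by
    rintro A ⟨i, hi, I, hI, rfl⟩
    exact mem_biUnion hi ⟨I, hI, rfl⟩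
  exact (s.finite_toSet.biUnion fun i hi => (finite_components_freeParams hS hi).image _).subset this

/-- The frontier of a component is the union of the closed arcs it contains. -/
theorem frontier_eq_sUnion_arcs (hS : (arrangementCrossings Φ s).Finite)
    (hU : IsComponentOf U (arrangementCompl Φ s)) :
    frontier U = ⋃₀ {A ∈ arrangementArcs Φ s | A ⊆ frontier U} := by
  have hR := isOpen_arrangementCompl Φ s
  have hfin : {A ∈ arrangementArcs Φ s | A ⊆ frontier U}.Finite :=
    (finite_arrangementArcs hS).subset fun A hA => hA.1
  refine subset_antisymm ?_ (sUnion_subset fun A hA => hA.2)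
  -- Points off the crossings are dense in the frontier, and a finite union of closed arcs is
  -- closed.
  refine (frontier_subset_closure_diff_finite (hU.isOpen hR) (interior_closure_arrangement hU)
    hS).trans (closure_minimal ?_ ?_)
  · rintro p ⟨hp, hpS⟩
    obtain ⟨i, hi, I, hI, hpI, hsub⟩ := exists_arc_of_frontier hU hp hpS
    refine ⟨chartArc (Φ i) (closure I), ⟨⟨i, hi, I, hI, rfl⟩, ?_⟩,
      hpI.1, subset_closure hpI.2⟩
    rw [(hU.isOpen hR).frontier_eq]
    intro q hq
    refine ⟨?_, fun hqU => hU.subset hqU i hi hq.1⟩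
    rw [← closure_chartArc] at hq
    exact closure_minimal hsub isClosed_closure hq
  · rw [sUnion_eq_biUnion]
    refine hfin.isClosed_biUnion ?_
    rintro A ⟨⟨i, hi, I, hI, rfl⟩, -⟩
    rw [← closure_chartArc]
    exact isClosed_closure

/-- The complement of an arrangement has finitely many components. -/
theorem finite_components_arrangement (hS : (arrangementCrossings Φ s).Finite) :
    {U | IsComponentOf U (arrangementCompl Φ s)}.Finite := by
  classical
  have hR := isOpen_arrangementCompl Φ s
  have hpairs : {q : ι × Set ℝ | q.1 ∈ s ∧ IsComponentOf q.2 (freeParams Φ s q.1)}.Finite := by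
    refine (s.finite_toSet.biUnion fun i hi =>
      (finite_components_freeParams hS hi).image (Prod.mk i)).subset ?_
    rintro ⟨i, I⟩ ⟨hi, hI⟩
    exact mem_biUnion (x := i) hi ⟨I, hI, rfl⟩
  -- `F` holds one point from each local side of the arc. A component with the arc in its closure
  -- contains one of these sides, so an arc accounts for at most two components.
  have hpt : ∀ q ∈ {q : ι × Set ℝ | q.1 ∈ s ∧ IsComponentOf q.2 (freeParams Φ s q.1)},
      ∃ F : Set Plane, F.Finite ∧ ∀ U, IsComponentOf U (arrangementCompl Φ s) →
        chartArc (Φ q.1) q.2 ⊆ closure U → ∃ x ∈ F, x ∈ U := by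
    rintro ⟨i, I⟩ ⟨hi, hI⟩
    obtain ⟨u, hu⟩ := hI.nonempty
    obtain ⟨N, P, M, hN, hpN, ⟨⟨x, hx⟩, hP⟩, ⟨⟨y, hy⟩, hM⟩, hPR, hMR, hNs, -, -⟩ :=
      exists_local_sides (s := s) (symm_mem_chartAxis (Φ i) u) (hI.subset hu)
    refine ⟨{x, y}, toFinite _, fun U hU hsub => ?_⟩
    obtain ⟨z, hzN, hzU⟩ := mem_closure_iff.1
      (hsub ⟨symm_mem_chartAxis (Φ i) u, by simpa using hu⟩) N hN hpN
    rcases hNs hzN with (h | h) | h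
    · exact ⟨x, by simp, hU.subset_of_inter hP hPR ⟨z, h, hzU⟩ hx⟩
    · exact ⟨y, by simp, hU.subset_of_inter hM hMR ⟨z, h, hzU⟩ hy⟩
    · exact (hU.subset hzU i hi h).elim
  choose! F hF hFU using hpt
  refine ((finite_singleton univ).union
    ((hpairs.biUnion hF).image (connectedComponentIn (arrangementCompl Φ s)))).subset ?_
  intro U (hU : IsComponentOf U _)
  by_cases hfr : frontier U = ∅
  · exact Or.inl ((isClopen_iff.1 (isClopen_iff_frontier_eq_empty.2 hfr)).resolve_left
      hU.nonempty.ne_empty)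
  · obtain ⟨p, hp, hpS⟩ : (frontier U \ arrangementCrossings Φ s).Nonempty := by
      by_contra hne
      have := frontier_subset_closure_diff_finite (hU.isOpen hR) (interior_closure_arrangement hU) hS
      rw [not_nonempty_iff_eq_empty.1 hne, closure_empty] at this
      exact hfr (subset_empty_iff.1 this)
    obtain ⟨i, hi, I, hI, -, hsub⟩ := exists_arc_of_frontier hU hp hpS
    obtain ⟨x, hxF, hxU⟩ := hFU (i, I) ⟨hi, hI⟩ U hU hsub
    exact Or.inr ⟨x, mem_biUnion (x := (i, I)) ⟨hi, hI⟩ hxF, (hU.eq_of_mem hxU).symm⟩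

/-- A connected set in the union of a closed set and a finite set that is not contained in the closed
set is a point. -/
theorem IsPreconnected.subset_singleton_of_union_finite {E : Type*} [TopologicalSpace E] [T1Space E]
    {K F S : Set E} (hK : IsPreconnected K) (hF : IsClosed F) (hS : S.Finite) (hKS : K ⊆ F ∪ S)
    {q : E} (hq : q ∈ K) (hqF : q ∉ F) : K ⊆ {q} := by
  have := isPreconnected_iff_subset_of_disjoint_closed.1 hK {q} (F ∪ (S \ {q}))
    isClosed_singleton (hF.union hS.sdiff.isClosed) ?_ ?_
  · rcases this with h | h
    · exact h
    · rcases h hq with h | h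
      · exact (hqF h).elim
      · exact (h.2 rfl).elim
  · intro x hx
    by_cases hxq : x = q
    · exact Or.inl hxq
    · rcases hKS hx with h | h
      · exact Or.inr (Or.inl h)
      · exact Or.inr (Or.inr ⟨h, hxq⟩)
  · rw [eq_empty_iff_forall_notMem]
    rintro x ⟨-, rfl, h | h⟩
    · exact hqF h
    · exact h.2 rfl

/-- A connected closed subset of the union of a line and a finite set is a retract of the plane. -/
theorem isRetract_of_subset_axis_union_finite {φ : Plane ≃ₜ ℝ × ℝ} {S K : Set Plane}
    (hS : S.Finite) (hK : IsClosed K) (hKc : IsConnected K) (hKS : K ⊆ chartAxis φ ∪ S) :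
    IsRetract K := by
  by_cases hsub : K ⊆ chartAxis φ
  · have hord : OrdConnected ((fun p => (φ p).1) '' K) :=
      (hKc.isPreconnected.image _ (by fun_prop)).ordConnected
    -- Tietze extension of the line coordinate, with values kept in the interval onto which it maps
    -- `K`.
    obtain ⟨g, hg, hgK⟩ := ContinuousMap.exists_restrict_eq_forall_mem_of_closed
      (⟨fun p => (φ p).1, by fun_prop⟩ : C(K, ℝ)) (t := (fun p => (φ p).1) '' K)
      (fun p => ⟨p, p.2, rfl⟩) (hKc.nonempty.image _) hK
    refine ⟨fun p => φ.symm (g p, 0), by fun_prop, fun p => ?_, fun p hp => ?_⟩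
    · obtain ⟨q, hq, hqp⟩ := hg p
      change φ.symm (g p, 0) ∈ K
      rw [← hqp]
      have := mem_chartAxis_iff.1 (hsub hq)
      simp only at this ⊢
      rwa [← this]
    · have : g p = (φ p).1 := congrFun (congrArg DFunLike.coe hgK) ⟨p, hp⟩
      change φ.symm (g p, 0) = p
      rw [this, ← mem_chartAxis_iff.1 (hsub hp)]
  · obtain ⟨p, hpK, hp⟩ := not_subset.1 hsub
    rw [subset_antisymm (hKc.isPreconnected.subset_singleton_of_union_finite
      (isClosed_chartAxis φ) hS hKS hpK hp) (singleton_subset_iff.2 hpK)]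
    exact isRetract_singleton p

end Arrangement

/-! ### Closures of components are retracts of the plane -/

section Arrangement

variable {ι : Type*} {Φ : ι → Plane ≃ₜ ℝ × ℝ}

theorem arrangementCompl_insert [DecidableEq ι] (s : Finset ι) (a : ι) :
    arrangementCompl Φ (insert a s) = arrangementCompl Φ s \ chartAxis (Φ a) := by
  ext p
  simp [arrangementCompl, and_comm]

theorem interior_chartAxis (φ : Plane ≃ₜ ℝ × ℝ) : interior (chartAxis φ) = ∅ := by
  have : chartAxis φ = φ ⁻¹' (univ ×ˢ {0}) := by ext p; simp [chartAxis]
  rw [this, ← φ.preimage_interior, interior_prod_eq]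
  simp

/-- The closure of a component of the complement of an arrangement is a retract of the plane. -/
theorem isRetract_closure_component
    (hfin : ∀ i j, i ≠ j → (chartAxis (Φ i) ∩ chartAxis (Φ j)).Finite) (s : Finset ι) :
    ∀ U, IsComponentOf U (arrangementCompl Φ s) → IsRetract (closure U) := by
  classical
  induction s using Finset.induction_on with
  | empty =>
    intro U hU
    have : arrangementCompl Φ ∅ = univ := by ext p; simp [arrangementCompl]
    rw [this] at hU
    have : U = univ := by
      obtain ⟨x, -, rfl⟩ := hU
      rw [connectedComponentIn_univ]
      exact PreconnectedSpace.connectedComponent_eq_univ x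
    rw [this, closure_univ]
    exact isRetract_univ
  | insert a s ha ih =>
    intro U' hU'
    have hR := isOpen_arrangementCompl Φ s
    have hR' := isOpen_arrangementCompl Φ (insert a s)
    have hsub : arrangementCompl Φ (insert a s) ⊆ arrangementCompl Φ s := by
      rw [arrangementCompl_insert]; exact sdiff_subset
    have hS := finite_arrangementCrossings Φ (insert a s) fun i _ j _ hij => hfin i j hij
    obtain ⟨x, hx⟩ := hU'.nonempty
    obtain ⟨U, hU, hxU⟩ := IsComponentOf.exists_mem (hsub (hU'.subset hx))
    have hU'U : U' ⊆ U :=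
      hU.subset_of_inter hU'.isPreconnected (hU'.subset.trans hsub) ⟨x, hx, hxU⟩
    have hUo := hU.isOpen hR
    have hU'o := hU'.isOpen hR'
    have hT := ih U hU
    -- `closure U` consists of `closure U'` and the closures of the components `Z` of `V`; these are
    -- the pieces to be collapsed.
    set V : Set Plane := U \ closure U' with hV
    have hVo : IsOpen V := hUo.sdiff isClosed_closure
    have hcell : ∀ W, IsComponentOf W (arrangementCompl Φ (insert a s)) → W ≠ U' →
        Disjoint W (closure U') := fun W hW hne =>
      (hW.disjoint hU' hne).closure_right (hW.isOpen hR')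
    have hZU' : ∀ Z, IsComponentOf Z V → Disjoint Z (closure U') := fun Z hZ =>
      Set.disjoint_left.2 fun p hp => (hZ.subset hp).2
    have hZU : ∀ Z, IsComponentOf Z V → Z ⊆ U := fun Z hZ p hp => (hZ.subset hp).1
    have hZo : ∀ Z, IsComponentOf Z V → IsOpen Z := fun Z hZ => hZ.isOpen hVo
    have hPZ : ∀ Z, IsComponentOf Z V → ∀ P, IsPreconnected P →
        P ⊆ arrangementCompl Φ (insert a s) → (P ∩ Z).Nonempty → P ⊆ Z := by
      rintro Z hZ P hP hPR ⟨z, hzP, hzZ⟩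
      refine hZ.subset_of_inter hP (fun p hp => ⟨?_, ?_⟩) ⟨z, hzP, hzZ⟩
      · exact hU.subset_of_inter hP (hPR.trans hsub) ⟨z, hzP, hZU Z hZ hzZ⟩ hp
      · obtain ⟨W, hW, hzW⟩ := IsComponentOf.exists_mem (hPR hzP)
        have hWU' : W ≠ U' := by
          rintro rfl
          exact Set.disjoint_left.1 (hZU' Z hZ) hzZ (subset_closure hzW)
        exact Set.disjoint_left.1 (hcell W hW hWU')
          (hW.subset_of_inter hP hPR ⟨z, hzP, hzW⟩ hp)
    -- The open set `Z` is not contained in the new line, so it contains a component of the finer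
    -- arrangement, and there are finitely many of those.
    have hZfin : {Z | IsComponentOf Z V}.Finite := by
      refine ((finite_components_arrangement hS).biUnion (t := fun W =>
        {Z | IsComponentOf Z V ∧ W ⊆ Z}) fun W hW => Set.Subsingleton.finite ?_).subset ?_
      · rintro Z ⟨hZ, hWZ⟩ Z' ⟨hZ', hWZ'⟩
        obtain ⟨w, hw⟩ := hW.nonempty
        exact hZ.eq_of_inter hZ' ⟨w, hWZ hw, hWZ' hw⟩
      · intro Z (hZ : IsComponentOf Z V)
        obtain ⟨z, hzZ, hza⟩ : (Z \ chartAxis (Φ a)).Nonempty := by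
          by_contra hne
          rw [not_nonempty_iff_eq_empty, sdiff_eq_empty] at hne
          obtain ⟨z, hz⟩ := hZ.nonempty
          have := interior_maximal hne (hZo Z hZ) hz
          rw [interior_chartAxis] at this
          exact this
        have hzR : z ∈ arrangementCompl Φ (insert a s) := by
          rw [arrangementCompl_insert]
          exact ⟨hU.subset (hZU Z hZ hzZ), hza⟩
        obtain ⟨W, hW, hzW⟩ := IsComponentOf.exists_mem hzR
        exact mem_biUnion (x := W) hW ⟨hZ, hPZ Z hZ W hW.isPreconnected hW.subset ⟨z, hzW, hzZ⟩⟩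
    have hU'Z : ∀ Z, IsComponentOf Z V → U' ⊆ U \ Z := fun Z hZ p hp =>
      ⟨hU'U hp, fun h => Set.disjoint_left.1 (hZU' Z hZ) h (subset_closure hp)⟩
    have hcover : ∀ Z, IsComponentOf Z V → closure Z ∪ closure (U \ Z) = closure U := by
      intro Z hZ
      rw [← closure_union, union_sdiff_cancel (hZU Z hZ)]
    -- Unicoherence of the retract `closure U`; `U \ Z` is connected because `Z` is a component of
    -- the complement in `U` of the connected set `closure U' ∩ U`.
    have hKpre : ∀ Z, IsComponentOf Z V → IsPreconnected (closure Z ∩ closure (U \ Z)) := by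
      intro Z hZ
      refine hT.isPreconnected_inter isClosed_closure isClosed_closure
        hZ.isPreconnected.closure (IsPreconnected.closure ?_) (hcover Z hZ)
      have hTpre : IsPreconnected (closure U' ∩ U) := hU'.isPreconnected.subset_closure
        (fun p hp => ⟨subset_closure hp, hU'U hp⟩) inter_subset_left
      have hVeq : U \ (closure U' ∩ U) = V := by
        rw [hV]; ext p; simp only [mem_sdiff, mem_inter_iff]; tauto
      refine hU.isPreconnected.diff_component inter_subset_right hTpre hZ.isPreconnected
        (hVeq ▸ hZ.subset) fun W hW hWV hZW => ?_
      obtain ⟨z, hz⟩ := hZ.nonempty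
      exact hZ.subset_of_inter hW (hVeq ▸ hWV) ⟨z, hZW hz, hz⟩
    have hKU : ∀ Z, IsComponentOf Z V → ∀ p ∈ closure Z ∩ closure (U \ Z), p ∈ U →
        p ∈ closure U' ∧ p ∈ chartAxis (Φ a) := by
      rintro Z hZ p ⟨hpZ, hpB⟩ hpU
      have hpU' : p ∈ closure U' := by
        by_contra hp
        have := hZ.closure_inter hVo ⟨hpZ, hpU, hp⟩
        obtain ⟨q, hq, hq'⟩ := mem_closure_iff.1 hpB Z (hZo Z hZ) this
        exact hq'.2 hq
      refine ⟨hpU', ?_⟩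
      by_contra hpa
      have hpR : p ∈ arrangementCompl Φ (insert a s) := by
        rw [arrangementCompl_insert]
        exact ⟨hU.subset hpU, hpa⟩
      have hp' := hU'.closure_inter hR' ⟨hpU', hpR⟩
      obtain ⟨q, hq, hq'⟩ := mem_closure_iff.1 hpZ U' hU'o hp'
      exact (hU'Z Z hZ hq).2 hq'
    -- At a frontier point of `U` on a single line only one local side lies in `U`. That side is
    -- connected, so it cannot meet both `Z` and `U \ Z`.
    have hKS : ∀ Z, IsComponentOf Z V → ∀ p ∈ closure Z ∩ closure (U \ Z), p ∉ U →
        p ∈ arrangementCrossings Φ (insert a s) := by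
      rintro Z hZ p ⟨hpZ, hpB⟩ hpU
      by_contra hpS
      have hpf : p ∈ frontier U := by
        rw [hUo.frontier_eq]
        exact ⟨closure_mono (hZU Z hZ) hpZ, hpU⟩
      obtain ⟨i, hi, hpi, -⟩ := exists_unique_axis hU hpf (fun ⟨i, hi, j, hj, h⟩ =>
        hpS ⟨i, Finset.mem_insert_of_mem hi, j, Finset.mem_insert_of_mem hj, h⟩)
      have hi' : i ∈ insert a s := Finset.mem_insert_of_mem hi
      obtain ⟨N, P, M, hN, hpN, hP, hM, hPR, hMR, hNs, hNP, hNM⟩ :=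
        exists_local_sides (s := insert a s) hpi
          (fun j hj hji h => hpS ⟨i, hi', j, hj, hji.symm, hpi, h⟩)
      obtain ⟨z, hzN, hzZ⟩ := mem_closure_iff.1 hpZ N hN hpN
      obtain ⟨w, hwN, hwU, hwZ⟩ := mem_closure_iff.1 hpB N hN hpN
      have hzU := hZU Z hZ hzZ
      have hboth : (P ∩ U).Nonempty → (M ∩ U).Nonempty → False := by
        intro h1 h2
        have h1' := hU.subset_of_inter hP.isPreconnected (hPR.trans hsub) h1
        have h2' := hU.subset_of_inter hM.isPreconnected (hMR.trans hsub) h2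
        apply hpU
        rw [← interior_closure_arrangement hU]
        refine mem_interior.2 ⟨N, fun q hq => ?_, hN, hpN⟩
        rcases hNs hq with (h | h) | h
        · exact subset_closure (h1' h)
        · exact subset_closure (h2' h)
        · exact closure_mono h1' (hNP ⟨hq, h⟩)
      have hside : ∀ q ∈ N, q ∈ U → q ∈ P ∨ q ∈ M := fun q hq hqU =>
        (hNs hq).resolve_right fun h => hU.subset hqU i hi h
      rcases hside z hzN hzU with hz | hz <;> rcases hside w hwN hwU with hw | hw
      · exact hwZ (hPZ Z hZ P hP.isPreconnected hPR ⟨z, hz, hzZ⟩ hw)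
      · exact hboth ⟨z, hz, hzU⟩ ⟨w, hw, hwU⟩
      · exact hboth ⟨w, hw, hwU⟩ ⟨z, hz, hzU⟩
      · exact hwZ (hPZ Z hZ M hM.isPreconnected hMR ⟨z, hz, hzZ⟩ hw)
    have hKne : ∀ Z, IsComponentOf Z V → ∃ p ∈ closure Z ∩ closure (U \ Z), p ∈ closure U' := by
      intro Z hZ
      obtain ⟨z, hz⟩ := hZ.nonempty
      obtain ⟨p, hpU, hp⟩ := isPreconnected_closed_iff.1 hU.isPreconnected (closure Z)
        (closure (U \ Z)) isClosed_closure isClosed_closure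
        (by rw [hcover Z hZ]; exact subset_closure) ⟨z, hZU Z hZ hz, subset_closure hz⟩
        ⟨x, hxU, subset_closure (hU'Z Z hZ hx)⟩
      exact ⟨p, hp, (hKU Z hZ p hp hpU).1⟩
    have : Finite {Z // IsComponentOf Z V} := hZfin.to_subtype
    refine hT.collapse (ι := {Z // IsComponentOf Z V}) (A := fun Z => closure Z.1)
      (K := fun Z => closure Z.1 ∩ closure (U \ Z.1)) isClosed_closure
      (fun _ => isClosed_closure) ?_ ?_ ?_ ?_ ?_
    · refine subset_antisymm (closure_minimal ?_ ?_) (union_subset (closure_mono hU'U)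
        (iUnion_subset fun Z => closure_mono (hZU Z.1 Z.2)))
      · intro p hp
        by_cases hpU' : p ∈ closure U'
        · exact Or.inl hpU'
        · obtain ⟨Z, hZ, hpZ⟩ := IsComponentOf.exists_mem (show p ∈ V from ⟨hp, hpU'⟩)
          exact Or.inr (mem_iUnion.2 ⟨⟨Z, hZ⟩, subset_closure hpZ⟩)
      · exact isClosed_closure.union (isClosed_iUnion_of_finite fun _ => isClosed_closure)
    · rintro ⟨Z, hZ⟩
      obtain ⟨p, hp, -⟩ := hKne Z hZ
      refine isRetract_of_subset_axis_union_finite (φ := Φ a)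
        (K := closure Z ∩ closure (U \ Z)) hS
        (isClosed_closure.inter isClosed_closure) ⟨⟨p, hp⟩, hKpre Z hZ⟩ fun q hq => ?_
      by_cases hqU : q ∈ U
      · exact Or.inl (hKU Z hZ q hq hqU).2
      · exact Or.inr (hKS Z hZ q hq hqU)
    · rintro ⟨Z, hZ⟩ q hq
      by_contra hqU'
      obtain ⟨p, hp, hpU'⟩ := hKne Z hZ
      -- A point of the connected set outside `closure U'` would be isolated in it, hence its only
      -- point, although the set does meet `closure U'`.
      have := (hKpre Z hZ).subset_singleton_of_union_finite (F := closure U') isClosed_closure hS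
        (fun r hr => by
          by_cases hrU : r ∈ U
          · exact Or.inl (hKU Z hZ r hr hrU).1
          · exact Or.inr (hKS Z hZ r hr hrU)) hq hqU' hp
      exact hqU' (mem_singleton_iff.1 this ▸ hpU')
    · rintro ⟨Z, hZ⟩ q ⟨hq, hqU'⟩
      exact ⟨hq, closure_mono (hU'Z Z hZ) hqU'⟩
    · rintro ⟨Z, hZ⟩ ⟨Z', hZ'⟩ hne q ⟨hq, hq'⟩
      have hsub' : Z' ⊆ U \ Z := fun r hr => ⟨hZU Z' hZ' hr, fun h =>
        Set.disjoint_left.1 (hZ.disjoint hZ' fun h => hne (Subtype.ext h)) h hr⟩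
      exact ⟨hq, closure_mono hsub' hq'⟩

end Arrangement

/-! ### Polynomial curves and the shape of `X` -/

/-- The chart of the plane straightening the rotated graph of a polynomial. -/
noncomputable def polyChart (f : Polynomial ℝ) (θ : ℝ) : Plane ≃ₜ ℝ × ℝ where
  toFun p := (frameX θ p, rotatedFun f θ p)
  invFun q := !₂[Real.cos θ * q.1 - Real.sin θ * (f.eval q.1 - q.2),
    Real.sin θ * q.1 + Real.cos θ * (f.eval q.1 - q.2)]
  left_inv p := by
    have h := Real.sin_sq_add_cos_sq θ
    ext i
    fin_cases i
    · simp only [rotatedFun, sub_sub_cancel, frameX, frameY]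
      simp
      linear_combination (p 0) * h
    · simp only [rotatedFun, sub_sub_cancel, frameX, frameY]
      simp
      linear_combination (p 1) * h
  right_inv q := by
    have h := Real.sin_sq_add_cos_sq θ
    have h1 : frameX θ !₂[Real.cos θ * q.1 - Real.sin θ * (f.eval q.1 - q.2),
        Real.sin θ * q.1 + Real.cos θ * (f.eval q.1 - q.2)] = q.1 := by
      simp [frameX]
      linear_combination q.1 * h
    refine Prod.ext h1 ?_
    simp only [rotatedFun, h1]
    simp [frameY]
    linear_combination (q.2 - f.eval q.1) * h
  continuous_toFun := by
    unfold rotatedFun frameX frameY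
    fun_prop
  continuous_invFun := by fun_prop

theorem chartAxis_polyChart (f : Polynomial ℝ) (θ : ℝ) :
    chartAxis (polyChart f θ) = polyCurve f θ := rfl

theorem chartArc_polyChart (f : Polynomial ℝ) (θ : ℝ) (I : Set ℝ) :
    chartArc (polyChart f θ) I = polyArc f θ I := rfl

theorem continuous_rotatedFun (f : Polynomial ℝ) (θ : ℝ) : Continuous (rotatedFun f θ) :=
  continuous_snd.comp (polyChart f θ).continuous

/-- Along a polynomial curve the defining function of another one is a polynomial in the
parameter. -/
theorem exists_polynomial_along (f : Polynomial ℝ) (θ : ℝ) (g : Polynomial ℝ) (φ : ℝ) :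
    ∃ Q : Polynomial ℝ, ∀ u, Q.eval u = rotatedFun g φ ((polyChart f θ).symm (u, 0)) := by
  let A : Polynomial ℝ := Polynomial.C (Real.cos θ) * Polynomial.X - Polynomial.C (Real.sin θ) * f
  let B : Polynomial ℝ := Polynomial.C (Real.sin θ) * Polynomial.X + Polynomial.C (Real.cos θ) * f
  refine ⟨g.comp (Polynomial.C (Real.cos φ) * A + Polynomial.C (Real.sin φ) * B) -
    (-Polynomial.C (Real.sin φ) * A + Polynomial.C (Real.cos φ) * B), fun u => ?_⟩
  simp [A, B, rotatedFun, frameX, frameY, polyChart]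

/-- A properly embedded line contained in another one equals it. -/
theorem chartAxis_eq_of_subset {φ ψ : Plane ≃ₜ ℝ × ℝ} (h : chartAxis φ ⊆ chartAxis ψ) :
    chartAxis φ = chartAxis ψ := by
  -- `k` reads the first line in the coordinate of the second. It is continuous and injective, hence
  -- strictly monotone with open range; the range is also closed, so it is all of `ℝ`.
  let k : ℝ → ℝ := fun u => (ψ (φ.symm (u, 0))).1
  have hk : Continuous k := by fun_prop
  have hpt : ∀ u, ψ.symm (k u, 0) = φ.symm (u, 0) := fun u =>
    (mem_chartAxis_iff.1 (h (symm_mem_chartAxis φ u))).symm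
  have hinj : Function.Injective k := by
    intro u v huv
    have : φ.symm (u, 0) = φ.symm (v, 0) := by rw [← hpt, ← hpt, huv]
    simpa using φ.symm.injective this
  have hrange : range k = {w | ψ.symm (w, 0) ∈ chartAxis φ} := by
    ext w
    constructor
    · rintro ⟨u, rfl⟩
      change ψ.symm (k u, 0) ∈ chartAxis φ
      rw [hpt]
      exact symm_mem_chartAxis φ u
    · intro hw
      refine ⟨(φ (ψ.symm (w, 0))).1, ?_⟩
      simp only [k]
      rw [← mem_chartAxis_iff.1 hw]
      simp
  have hcl : IsClosed (range k) := by
    rw [hrange]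
    exact (isClosed_chartAxis φ).preimage (show Continuous fun w : ℝ => ψ.symm (w, 0) by fun_prop)
  have hop : IsOpen (range k) := by
    have hmono : ∀ k : ℝ → ℝ, Continuous k → StrictMono k → IsOpen (range k) := by
      intro k hk hm
      rw [isOpen_iff_mem_nhds]
      rintro _ ⟨u, rfl⟩
      refine Filter.mem_of_superset (Icc_mem_nhds (hm (show u - 1 < u by linarith))
        (hm (show u < u + 1 by linarith))) ?_
      exact (intermediate_value_Icc (by linarith) hk.continuousOn).trans (image_subset_range _ _)
    rcases hk.strictMono_of_inj hinj with hm | hm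
    · exact hmono k hk hm
    · have := hmono (fun u => -k u) hk.neg hm.neg
      have heq : range k = (fun x => -x) ⁻¹' range (fun u => -k u) := by
        ext w; simp
      rw [heq]
      exact this.preimage continuous_neg
  have huniv : range k = univ := (isClopen_iff.1 ⟨hcl, hop⟩).resolve_left (range_nonempty k).ne_empty
  refine subset_antisymm h fun p hp => ?_
  obtain ⟨u, hu⟩ : (ψ p).1 ∈ range k := huniv ▸ mem_univ _
  rw [mem_chartAxis_iff.1 hp, ← hu, hpt]
  exact symm_mem_chartAxis φ u

/-- Distinct polynomial curves have finitely many common points. -/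
theorem finite_polyCurve_inter {f g : Polynomial ℝ} {θ φ : ℝ}
    (hne : polyCurve f θ ≠ polyCurve g φ) : (polyCurve f θ ∩ polyCurve g φ).Finite := by
  obtain ⟨Q, hQ⟩ := exists_polynomial_along f θ g φ
  by_cases hQ0 : Q = 0
  · refine (hne (chartAxis_eq_of_subset (φ := polyChart f θ) (ψ := polyChart g φ) ?_)).elim
    intro p hp
    have := hQ ((polyChart f θ) p).1
    rw [← mem_chartAxis_iff.1 hp, hQ0, Polynomial.eval_zero] at this
    exact this.symm
  · refine ((Q.finite_setOfPred_isRoot hQ0).image fun u => (polyChart f θ).symm (u, 0)).subset ?_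
    rintro p ⟨hp, hpg⟩
    refine ⟨(polyChart f θ p).1, ?_, (mem_chartAxis_iff.1 hp).symm⟩
    change Q.eval _ = 0
    rw [hQ, ← mem_chartAxis_iff.1 hp]
    exact hpg

/-- Finitely many polynomial curves form an arrangement, repetitions being dropped. -/
theorem exists_arrangement {k : ℕ} (f : Fin k → Polynomial ℝ) (β : Fin k → ℝ) :
    ∃ (n : ℕ) (r : Fin n → Fin k),
      (∀ i j, i ≠ j → (polyCurve (f (r i)) (β (r i)) ∩ polyCurve (f (r j)) (β (r j))).Finite) ∧
      ∀ j, ∃ i, polyCurve (f (r i)) (β (r i)) = polyCurve (f j) (β j) := by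
  obtain ⟨n, C, hC, hrange⟩ := (finite_range fun j => polyCurve (f j) (β j)).fin_param
  have hmem : ∀ i, ∃ j, polyCurve (f j) (β j) = C i := fun i => by
    have : C i ∈ range C := mem_range_self i
    rwa [hrange] at this
  choose r hr using hmem
  refine ⟨n, r, fun i j hij => finite_polyCurve_inter ?_, fun j => ?_⟩
  · rw [hr, hr]
    exact fun h => hij (hC h)
  · have : polyCurve (f j) (β j) ∈ range C := hrange ▸ mem_range_self j
    obtain ⟨i, hi⟩ := this
    exact ⟨i, by rw [hr, hi]⟩

theorem isPolySide_of_mem_arcs {n : ℕ} {f : Fin n → Polynomial ℝ} {β : Fin n → ℝ} {A : Set Plane}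
    (hA : A ∈ arrangementArcs (fun i => polyChart (f i) (β i)) Finset.univ) : IsPolySide A := by
  obtain ⟨i, -, I, hI, rfl⟩ := hA
  have hIo := hI.isOpen (isOpen_freeParams i)
  refine ⟨f i, β i, closure I, isClosed_closure, hI.isPreconnected.closure.ordConnected, ?_,
    chartArc_polyChart _ _ _⟩
  obtain ⟨u, hu⟩ := hI.nonempty
  obtain ⟨ε, hε, hball⟩ := Metric.isOpen_iff.1 hIo u hu
  refine ⟨u, subset_closure hu, u + ε / 2, subset_closure (hball ?_), by linarith⟩
  rw [Metric.mem_ball, Real.dist_eq, add_sub_cancel_left, abs_of_pos (by linarith)]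
  linarith

/-- Components of the complement of an arrangement of polynomial curves are regions of type II. -/
theorem isTypeIIRegion_of_component {n : ℕ} {f : Fin n → Polynomial ℝ} {β : Fin n → ℝ}
    (hfin : ∀ i j, i ≠ j → (polyCurve (f i) (β i) ∩ polyCurve (f j) (β j)).Finite)
    {U : Set Plane} (hU : IsComponentOf U
      (arrangementCompl (fun i => polyChart (f i) (β i)) Finset.univ)) : IsTypeIIRegion U := by
  have hreg := interior_closure_arrangement hU
  have hUo := hU.isOpen (isOpen_arrangementCompl _ _)
  have hS := finite_arrangementCrossings (fun i => polyChart (f i) (β i)) Finset.univ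
    fun i _ j _ hij => hfin i j hij
  have hfr : frontier (closure U) = frontier U := by
    rw [isClosed_closure.frontier_eq, hreg, hUo.frontier_eq]
  refine ⟨closure U, ⟨isClosed_closure, ?_, ?_, ?_, ?_⟩, ?_⟩
  · exact (isRetract_closure_component hfin _ U hU).isSimplyConnected
  · rw [hreg]; exact hU.isConnected
  · rw [hreg]
  · have hfinA : {A ∈ arrangementArcs (fun i => polyChart (f i) (β i)) Finset.univ |
        A ⊆ frontier U}.Finite := (finite_arrangementArcs hS).subset fun A hA => hA.1
    obtain ⟨N, S, -, hrange⟩ := hfinA.fin_param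
    refine ⟨N, S, fun i => ?_, ?_⟩
    · have : S i ∈ range S := mem_range_self i
      rw [hrange] at this
      exact isPolySide_of_mem_arcs this.1
    · rw [hfr, frontier_eq_sUnion_arcs hS hU, ← hrange, sUnion_range]
  · rw [hfr, hUo.frontier_eq]
    ext p
    simp only [mem_sdiff, not_and, not_not]
    exact ⟨fun h => ⟨subset_closure h, fun _ => h⟩, fun h => h.2 h.1⟩

/-- A finite intersection of open polynomial half planes is a finite disjoint union of regions of
type II. -/
theorem isFiniteDisjointUnionOf_typeII {k : ℕ} (f : Fin k → Polynomial ℝ) (β : Fin k → ℝ) :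
    IsFiniteDisjointUnionOf IsTypeIIRegion (⋂ j, openPolyHalfPlane (f j) (β j)) := by
  obtain ⟨n, r, hfin, hr⟩ := exists_arrangement f β
  set R := arrangementCompl (fun i => polyChart (f (r i)) (β (r i))) Finset.univ with hRdef
  have hR : ∀ p, p ∈ R ↔ ∀ j, rotatedFun (f j) (β j) p ≠ 0 := by
    intro p
    constructor
    · intro hp j hj
      obtain ⟨i, hi⟩ := hr j
      exact hp i (Finset.mem_univ i) (by rw [chartAxis_polyChart, hi]; exact hj)
    · intro hp i _ hi
      exact hp (r i) hi
  have hS := finite_arrangementCrossings (fun i => polyChart (f (r i)) (β (r i))) Finset.univ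
    fun i _ j _ hij => hfin i j hij
  set X := ⋂ j, openPolyHalfPlane (f j) (β j) with hX
  have hXmem : ∀ p, p ∈ X ↔ ∀ j, 0 < rotatedFun (f j) (β j) p := by
    intro p; rw [hX, mem_iInter]; rfl
  -- No defining function vanishes on the connected set `U`, so each keeps its sign there.
  have hsub : ∀ U, IsComponentOf U R → (U ∩ X).Nonempty → U ⊆ X := by
    rintro U hU ⟨x, hxU, hxX⟩ p hp
    rw [hXmem] at hxX ⊢
    intro j
    have hcont := continuous_rotatedFun (f j) (β j)
    have := hU.isPreconnected.subset_left_of_subset_union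
      (u := {q | 0 < rotatedFun (f j) (β j) q}) (v := {q | rotatedFun (f j) (β j) q < 0})
      (isOpen_lt continuous_const hcont) (isOpen_lt hcont continuous_const)
      (Set.disjoint_left.2 fun q h1 h2 =>
        lt_asymm (show 0 < rotatedFun (f j) (β j) q from h1) h2)
      (fun q hq => ((hR q).1 (hU.subset hq) j).lt_or_gt.symm) ⟨x, hxU, hxX j⟩
    exact this hp
  have hfinU : {U | IsComponentOf U R ∧ U ⊆ X}.Finite :=
    (finite_components_arrangement hS).subset fun U hU => hU.1
  obtain ⟨N, S, hinj, hrange⟩ := hfinU.fin_param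
  have hSi : ∀ i, IsComponentOf (S i) R ∧ S i ⊆ X := fun i => by
    have : S i ∈ range S := mem_range_self i
    rwa [hrange] at this
  refine ⟨N, S, fun i => isTypeIIRegion_of_component hfin (hSi i).1,
    fun i j hij => (hSi i).1.disjoint (hSi j).1 fun h => hij (hinj h), ?_⟩
  refine subset_antisymm (fun p hp => ?_) (iUnion_subset fun i => (hSi i).2)
  obtain ⟨U, hU, hpU⟩ := IsComponentOf.exists_mem ((hR p).2 fun j => ((hXmem p).1 hp j).ne')
  have : U ∈ range S := hrange ▸ ⟨hU, hsub U hU ⟨p, hpU, hp⟩⟩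
  obtain ⟨i, rfl⟩ := this
  exact mem_iUnion.2 ⟨i, hpU⟩

/-- The part of a polynomial curve over an open set with finite frontier is a finite disjoint union
of open polynomial curves. -/
theorem isFiniteDisjointUnionOf_openPolyCurve (h : Polynomial ℝ) (φ : ℝ) {O : Set ℝ}
    (hO : IsOpen O) (hfin : (frontier O).Finite) :
    IsFiniteDisjointUnionOf (IsOpenPolyCurveOn h φ) (polyArc h φ O) := by
  obtain ⟨N, S, hinj, hrange⟩ := (hO.finite_components_of_frontier hfin).fin_param
  have hSi : ∀ i, IsComponentOf (S i) O := fun i => by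
    have : S i ∈ range S := mem_range_self i
    rwa [hrange] at this
  refine ⟨N, fun i => polyArc h φ (S i), fun i => ?_, fun i j hij => ?_, ?_⟩
  · change IsOpenPolyCurveOn h φ (polyArc h φ (S i))
    rcases (hSi i).isPreconnected.eq_open_interval ((hSi i).isOpen hO) (hSi i).nonempty with
      hI | ⟨a, hI | hI⟩ | ⟨a, b, hab, hI⟩
    · exact Or.inl (by rw [hI]; ext p; simp [polyArc])
    · exact Or.inr (Or.inl ⟨a, Or.inl (by rw [hI])⟩)
    · exact Or.inr (Or.inl ⟨a, Or.inr (by rw [hI])⟩)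
    · exact Or.inr (Or.inr ⟨a, b, hab, by rw [hI]⟩)
  · have := (hSi i).disjoint (hSi j) fun h => hij (hinj h)
    exact Set.disjoint_left.2 fun p hp hq => Set.disjoint_left.1 this hp.2 hq.2
  · ext p
    simp only [mem_iUnion]
    constructor
    · rintro ⟨hp, hpO⟩
      obtain ⟨I, hI, hpI⟩ := IsComponentOf.exists_mem hpO
      obtain ⟨i, rfl⟩ : I ∈ range S := hrange ▸ hI
      exact ⟨i, hp, hpI⟩
    · rintro ⟨i, hp, hpi⟩
      exact ⟨hp, (hSi i).subset hpi⟩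

/-- With at least one equation, the set is finite or lies over an open set with finite frontier. -/
theorem finite_or_eq_polyArc {m k : ℕ} (g : Fin m → Polynomial ℝ) (θ : Fin m → ℝ)
    (f : Fin k → Polynomial ℝ) (β : Fin k → ℝ) (i₀ : Fin m) :
    ((⋂ i, polyCurve (g i) (θ i)) ∩ ⋂ j, openPolyHalfPlane (f j) (β j)).Finite ∨
    ∃ O : Set ℝ, IsOpen O ∧ (frontier O).Finite ∧
      (⋂ i, polyCurve (g i) (θ i)) ∩ ⋂ j, openPolyHalfPlane (f j) (β j) =
        polyArc (g i₀) (θ i₀) O := by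
  choose Q hQ using fun i => exists_polynomial_along (g i₀) (θ i₀) (g i) (θ i)
  choose P hP using fun j => exists_polynomial_along (g i₀) (θ i₀) (f j) (β j)
  set X := (⋂ i, polyCurve (g i) (θ i)) ∩ ⋂ j, openPolyHalfPlane (f j) (β j) with hX
  set φ := polyChart (g i₀) (θ i₀)
  have hXax : ∀ p ∈ X, p ∈ chartAxis φ := fun p hp => mem_iInter.1 hp.1 i₀
  have hmem : ∀ p ∈ chartAxis φ,
      (p ∈ X ↔ (∀ i, (Q i).eval (φ p).1 = 0) ∧ ∀ j, 0 < (P j).eval (φ p).1) := by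
    intro p hp
    simp only [hQ, hP]
    rw [← mem_chartAxis_iff.1 hp]
    simp [hX, polyCurve, openPolyHalfPlane]
  -- A nonzero `Q i` leaves finitely many parameters. If all vanish, only inequalities remain: a
  -- zero `P j` makes them unsolvable, and otherwise the frontier of the solution set consists of
  -- roots.
  by_cases hQ0 : ∀ i, Q i = 0
  · by_cases hP0 : ∃ j, P j = 0
    · obtain ⟨j, hj⟩ := hP0
      left
      convert! finite_empty
      rw [eq_empty_iff_forall_notMem]
      intro p hp
      have := ((hmem p (hXax p hp)).1 hp).2 j
      simp [hj] at this
    · right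
      push Not at hP0
      have hO : IsOpen {u | ∀ j, 0 < (P j).eval u} := by
        have : {u | ∀ j, 0 < (P j).eval u} = ⋂ j, {u | 0 < (P j).eval u} := by ext; simp
        rw [this]
        exact isOpen_iInter_of_finite fun j => isOpen_lt continuous_const (P j).continuous
      refine ⟨{u | ∀ j, 0 < (P j).eval u}, hO, ?_, ?_⟩
      · refine (finite_iUnion fun j => (P j).finite_setOfPred_isRoot (hP0 j)).subset ?_
        rw [hO.frontier_eq]
        rintro u ⟨hu, hu'⟩
        simp only [mem_ofPred_eq, not_forall, not_lt] at hu'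
        obtain ⟨j, hj⟩ := hu'
        refine mem_iUnion.2 ⟨j, le_antisymm hj ?_⟩
        have : closure {u | ∀ j, 0 < (P j).eval u} ⊆ {u | 0 ≤ (P j).eval u} :=
          closure_minimal (fun v hv => le_of_lt (hv j))
            (isClosed_le continuous_const (P j).continuous)
        exact this hu
      · ext p
        constructor
        · intro hp
          exact ⟨hXax p hp, ((hmem p (hXax p hp)).1 hp).2⟩
        · rintro ⟨hp, hpO⟩
          exact (hmem p hp).2 ⟨fun i => by simp [hQ0 i], hpO⟩
  · push Not at hQ0
    obtain ⟨i, hi⟩ := hQ0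
    left
    refine (((Q i).finite_setOfPred_isRoot hi).image fun u => φ.symm (u, 0)).subset fun p hp => ?_
    exact ⟨(φ p).1, ((hmem p (hXax p hp)).1 hp).1 i, (mem_chartAxis_iff.1 (hXax p hp)).symm⟩

/-! ### Shortest curves and shortcuts -/

/-- Length is additive. -/
theorem eVariationOn_Icc_add_Icc {E : Type*} [PseudoEMetricSpace E] (γ : ℝ → E) {a b c : ℝ}
    (hab : a ≤ b) (hbc : b ≤ c) :
    eVariationOn γ (Icc a b) + eVariationOn γ (Icc b c) = eVariationOn γ (Icc a c) := by
  simpa using eVariationOn.Icc_add_Icc γ hab hbc (mem_univ b)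

/-- Piecewise `C²` curves have finite length. -/
theorem IsPiecewiseC2.eVariationOn_ne_top {γ : ℝ → Plane} {a b : ℝ} (h : IsPiecewiseC2 γ a b) :
    eVariationOn γ (Icc a b) ≠ ⊤ := by
  obtain ⟨-, P, hP, h⟩ := h
  induction P, hP using Set.Finite.induction_on generalizing a b with
  | empty =>
    rcases lt_or_ge a b with hab | hab
    · obtain ⟨K, hK⟩ := (h a b le_rfl hab le_rfl (disjoint_empty _)).exists_lipschitzOnWith
        two_ne_zero (convex_Icc a b) isCompact_Icc
      have := hK.locallyBoundedVariationOn a b (left_mem_Icc.2 hab.le) (right_mem_Icc.2 hab.le)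
      rwa [inter_self] at this
    · rw [eVariationOn.subsingleton γ (subsingleton_Icc_of_ge hab)]
      exact ENNReal.zero_ne_top
  | @insert p P hpP hP ih =>
    -- An inner break point cuts the interval into two that it no longer affects; any other break
    -- point is irrelevant from the start.
    by_cases hp : p ∈ Ioo a b
    · rw [← eVariationOn_Icc_add_Icc γ hp.1.le hp.2.le]
      refine ENNReal.add_ne_top.2 ⟨ih fun s t hs hst ht hd => ?_, ih fun s t hs hst ht hd => ?_⟩
      · refine h s t hs hst (ht.trans hp.2.le) (disjoint_insert_right.2 ⟨fun hp' => ?_, hd⟩)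
        exact absurd hp'.2 (not_lt.2 ht)
      · refine h s t (hp.1.le.trans hs) hst ht (disjoint_insert_right.2 ⟨fun hp' => ?_, hd⟩)
        exact absurd hp'.1 (not_lt.2 hs)
    · refine ih fun s t hs hst ht hd => h s t hs hst ht (disjoint_insert_right.2 ⟨fun hp' => ?_, hd⟩)
      exact hp ⟨hs.trans_lt hp'.1, hp'.2.trans_le ht⟩

/-- The curve obtained from `γ` by running through a segment between the times `s` and `t`. -/
noncomputable def shortcut (γ : ℝ → Plane) (s t : ℝ) : ℝ → Plane := fun x =>
  if x ∈ Icc s t then AffineMap.lineMap (γ s) (γ t) ((x - s) / (t - s)) else γ x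

section Shortcut

variable {γ : ℝ → Plane} {s t : ℝ}

theorem shortcut_eqOn_Icc : EqOn (shortcut γ s t)
    (fun x => AffineMap.lineMap (γ s) (γ t) ((x - s) / (t - s))) (Icc s t) :=
  fun _ hx => if_pos hx

theorem shortcut_eqOn_Iic (hst : s < t) : EqOn (shortcut γ s t) γ (Iic s) := by
  intro x hx
  rcases (mem_Iic.1 hx).eq_or_lt with rfl | h
  · rw [shortcut_eqOn_Icc (left_mem_Icc.2 hst.le)]
    simp
  · exact if_neg fun h' => absurd h'.1 (not_le.2 h)

theorem shortcut_eqOn_Ici (hst : s < t) : EqOn (shortcut γ s t) γ (Ici t) := by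
  intro x hx
  rcases (mem_Ici.1 hx).eq_or_lt with rfl | h
  · rw [shortcut_eqOn_Icc (right_mem_Icc.2 hst.le)]
    simp [div_self (sub_pos.2 hst).ne']
  · exact if_neg fun h' => absurd h'.2 (not_le.2 h)

theorem contDiff_lineMap_param :
    ContDiff ℝ 2 fun x : ℝ => AffineMap.lineMap (γ s) (γ t) ((x - s) / (t - s)) := by
  simp only [AffineMap.lineMap_apply_module']
  fun_prop

theorem shortcut_mem_segment (hst : s < t) {x : ℝ} (hx : x ∈ Icc s t) :
    shortcut γ s t x ∈ segment ℝ (γ s) (γ t) := by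
  rw [shortcut_eqOn_Icc hx, segment_eq_image_lineMap]
  have h := sub_pos.2 hst
  exact ⟨_, ⟨div_nonneg (sub_nonneg.2 hx.1) h.le, (div_le_one h).2 (by linarith [hx.2])⟩, rfl⟩

/-- An affine map with Lipschitz constant `dist (γ s) (γ t)`, run through by a monotone parameter
going from `0` to `1`. -/
theorem eVariationOn_shortcut_le (hst : s < t) :
    eVariationOn (shortcut γ s t) (Icc s t) ≤ edist (γ s) (γ t) := by
  rw [eVariationOn.eq_of_eqOn shortcut_eqOn_Icc]
  have hl : LipschitzOnWith (nndist (γ s) (γ t)) (AffineMap.lineMap (γ s) (γ t) : ℝ → Plane) univ :=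
    (lipschitzWith_lineMap (γ s) (γ t)).lipschitzOnWith
  have h := hl.comp_eVariationOn_le (g := fun x : ℝ => (x - s) / (t - s)) (s := Icc s t)
    (mapsTo_univ _ _)
  have hpos := sub_pos.2 hst
  have hm : MonotoneOn (fun x : ℝ => (x - s) / (t - s)) univ := by
    intro x _ y _ hxy
    exact div_le_div_of_nonneg_right (by linarith) hpos.le
  have h2 := (hm.eVariationOn_eq (mem_univ s) (mem_univ t)).le
  rw [univ_inter, sub_self, zero_div, sub_zero, div_self hpos.ne', ENNReal.ofReal_one] at h2
  calc _ ≤ _ := h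
    _ ≤ (nndist (γ s) (γ t) : ENNReal) * 1 := by gcongr
    _ = edist (γ s) (γ t) := by rw [mul_one, edist_nndist]

theorem IsPiecewiseC2.shortcut {a b : ℝ} (h : IsPiecewiseC2 γ a b) (has : a ≤ s) (hst : s < t)
    (htb : t ≤ b) : IsPiecewiseC2 (shortcut γ s t) a b := by
  obtain ⟨hc, P, hP, h⟩ := h
  refine ⟨?_, insert s (insert t P), (hP.insert t).insert s, fun x y hx hxy hy hd => ?_⟩
  · have : Icc a b = Icc a s ∪ Icc s t ∪ Icc t b := by
      rw [Icc_union_Icc_eq_Icc has hst.le, Icc_union_Icc_eq_Icc (has.trans hst.le) htb]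
    rw [this]
    refine ((ContinuousOn.union_of_isClosed ?_ ?_ isClosed_Icc isClosed_Icc).union_of_isClosed ?_
      (isClosed_Icc.union isClosed_Icc) isClosed_Icc)
    · exact (hc.mono (Icc_subset_Icc_right (hst.le.trans htb))).congr
        ((shortcut_eqOn_Iic hst).mono Icc_subset_Iic_self)
    · exact contDiff_lineMap_param.continuous.continuousOn.congr shortcut_eqOn_Icc
    · exact (hc.mono (Icc_subset_Icc_left (has.trans hst.le))).congr
        ((shortcut_eqOn_Ici hst).mono Icc_subset_Ici_self)
  · rw [disjoint_insert_right, disjoint_insert_right] at hd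
    obtain ⟨hs, ht, hd⟩ := hd
    rw [mem_Ioo, not_and, not_lt] at hs ht
    rcases le_or_gt y s with hys | hys
    · exact (h x y hx hxy hy hd).congr ((shortcut_eqOn_Iic hst).mono fun z hz => hz.2.trans hys)
    rcases le_or_gt t x with htx | htx
    · exact (h x y hx hxy hy hd).congr ((shortcut_eqOn_Ici hst).mono fun z hz => htx.trans hz.1)
    · have hsx : s ≤ x := not_lt.1 fun h => absurd (hs h) (not_le.2 hys)
      have hyt : y ≤ t := ht htx
      exact contDiff_lineMap_param.contDiffOn.congr
        (shortcut_eqOn_Icc.mono (Icc_subset_Icc hsx hyt))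

end Shortcut

/-- If the segment between two points of a shortest curve in `X` lies in `X`, the curve runs along
this segment. -/
theorem IsShortestCurve.mem_segment {X : Set Plane} {γ : ℝ → Plane} {a b s t w : ℝ}
    (h : IsShortestCurve X γ a b) (has : a ≤ s) (htb : t ≤ b) (hw : w ∈ Icc s t)
    (hseg : segment ℝ (γ s) (γ t) ⊆ X) : γ w ∈ segment ℝ (γ s) (γ t) := by
  obtain ⟨hab, hC2, hX, hmin⟩ := h
  rcases (hw.1.trans hw.2).eq_or_lt with rfl | hst
  · rw [le_antisymm hw.2 hw.1]
    exact left_mem_segment ℝ _ _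
  have hle := hmin (shortcut γ s t) a b hab (hC2.shortcut has hst htb) (fun x hx => ?_)
    (shortcut_eqOn_Iic hst has) (shortcut_eqOn_Ici hst htb)
  -- The finite lengths outside `[s, t]` cancel, so the part of `γ` over `[s, t]` is no longer than
  -- the chord. This forces equality in the triangle inequality at `γ w`.
  · have hadd : ∀ δ : ℝ → Plane, eVariationOn δ (Icc a b) =
        eVariationOn δ (Icc a s) + eVariationOn δ (Icc s t) + eVariationOn δ (Icc t b) := fun δ => by
      rw [eVariationOn_Icc_add_Icc δ has hst.le, eVariationOn_Icc_add_Icc δ (has.trans hst.le) htb]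
    have hfin := hC2.eVariationOn_ne_top
    rw [hadd γ, hadd (shortcut γ s t),
      eVariationOn.eq_of_eqOn ((shortcut_eqOn_Iic hst).mono Icc_subset_Iic_self),
      eVariationOn.eq_of_eqOn ((shortcut_eqOn_Ici hst).mono Icc_subset_Ici_self)] at hle
    rw [hadd γ, ENNReal.add_ne_top, ENNReal.add_ne_top] at hfin
    rw [ENNReal.add_le_add_iff_right hfin.2, ENNReal.add_le_add_iff_left hfin.1.1] at hle
    have h1 : edist (γ s) (γ w) + edist (γ w) (γ t) ≤ edist (γ s) (γ t) := by
      refine le_trans ?_ (hle.trans (eVariationOn_shortcut_le hst))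
      rw [← eVariationOn_Icc_add_Icc γ hw.1 hw.2]
      exact add_le_add
        (eVariationOn.edist_le γ (left_mem_Icc.2 hw.1) (right_mem_Icc.2 hw.1))
        (eVariationOn.edist_le γ (left_mem_Icc.2 hw.2) (right_mem_Icc.2 hw.2))
    simp only [edist_dist] at h1
    rw [← ENNReal.ofReal_add dist_nonneg dist_nonneg,
      ENNReal.ofReal_le_ofReal_iff dist_nonneg] at h1
    rw [mem_segment_iff_wbtw, ← dist_add_dist_eq_iff]
    exact le_antisymm h1 (dist_triangle _ _ _)
  · by_cases hxst : x ∈ Icc s t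
    · exact hseg (shortcut_mem_segment hst hxst)
    · have : shortcut γ s t x = γ x := if_neg hxst
      rw [this]
      exact hX hx

/-- The times spent in `e` form an interval, so there is at most one interaction. -/
theorem interactsFinitely_of_ordConnected {γ : ℝ → Plane} {a b : ℝ} {e : Set Plane}
    (h : ∀ s t w, a ≤ s → t ≤ b → w ∈ Icc s t → γ s ∈ e → γ t ∈ e → γ w ∈ e) :
    InteractsFinitely γ a b e := by
  have hord : OrdConnected {t : ℝ | t ∈ Icc a b ∧ γ t ∈ e} := ⟨by
    rintro s ⟨hs, hse⟩ t ⟨ht, hte⟩ w hw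
    exact ⟨⟨hs.1.trans hw.1, hw.2.trans ht.2⟩, h s t w hs.1 ht.2 hw hse hte⟩⟩
  have : PreconnectedSpace {t : ℝ // t ∈ Icc a b ∧ γ t ∈ e} :=
    Subtype.preconnectedSpace hord.isPreconnected
  unfold InteractsFinitely
  infer_instance

/-- A shortest curve meets a convex subset of `X` during a time interval. -/
theorem IsShortestCurve.interactsFinitely_of_convex {X e : Set Plane} {γ : ℝ → Plane} {a b : ℝ}
    (h : IsShortestCurve X γ a b) (he : Convex ℝ e) (heX : e ⊆ X) : InteractsFinitely γ a b e :=
  interactsFinitely_of_ordConnected fun _ _ _ hs ht hw hse hte =>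
    he.segment_subset hse hte
      (h.mem_segment hs ht hw ((he.segment_subset hse hte).trans heX))

/-- A shortest curve in a part of a line meets each sub-arc during a time interval. -/
theorem IsShortestCurve.interactsFinitely_of_arc {X : Set Plane} {φ : Plane ≃ₜ ℝ × ℝ} {I : Set ℝ}
    {γ : ℝ → Plane} {a b : ℝ} (h : IsShortestCurve X γ a b) (hX : X ⊆ chartAxis φ)
    (hI : OrdConnected I) : InteractsFinitely γ a b (chartArc φ I) := by
  have hγX : ∀ x ∈ Icc a b, γ x ∈ X := h.2.2.1
  have hinj : ∀ x ∈ Icc a b, ∀ y ∈ Icc a b, (φ (γ x)).1 = (φ (γ y)).1 → γ x = γ y := by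
    intro x hx y hy hxy
    rw [mem_chartAxis_iff.1 (hX (hγX x hx)), hxy, ← mem_chartAxis_iff.1 (hX (hγX y hy))]
  -- a shortest curve does not come back to a point it has left
  have hret : ∀ x y w, a ≤ x → y ≤ b → w ∈ Icc x y → γ x = γ y → γ w = γ x := by
    intro x y w hx hy hw hxy
    have := h.mem_segment hx hy hw (by
      rw [← hxy, segment_same, singleton_subset_iff]
      exact hγX x ⟨hx, hw.1.trans (hw.2.trans hy)⟩)
    rwa [← hxy, segment_same, mem_singleton_iff] at this
  have hcont : ContinuousOn (fun x => (φ (γ x)).1) (Icc a b) :=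
    (show Continuous fun p => (φ p).1 by fun_prop).comp_continuousOn h.2.1.1
  refine interactsFinitely_of_ordConnected fun s t w hs ht hw hse hte => ?_
  have hwab : w ∈ Icc a b := ⟨hs.trans hw.1, hw.2.trans ht⟩
  have hsab : s ∈ Icc a b := ⟨hs, hw.1.trans hwab.2⟩
  have htab : t ∈ Icc a b := ⟨hwab.1.trans hw.2, ht⟩
  have hivt1 := hcont.mono (Icc_subset_Icc hs hwab.2)
  have hivt2 := hcont.mono (Icc_subset_Icc hwab.1 ht)
  have hleft : ∀ x ∈ Icc s w, γ x = γ t → γ w = γ t := fun x hx hxt => by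
    rw [← hxt]
    exact hret x t w (hs.trans hx.1) ht ⟨hx.2, hw.2⟩ hxt
  have hright : ∀ x ∈ Icc w t, γ x = γ s → γ w = γ s := fun x hx hxs =>
    hret s x w hs (hx.2.trans ht) ⟨hw.1, hx.1⟩ hxs.symm
  have hLe : ∀ x ∈ Icc s w, x ∈ Icc a b := fun x hx => ⟨hs.trans hx.1, hx.2.trans hwab.2⟩
  have hRe : ∀ x ∈ Icc w t, x ∈ Icc a b := fun x hx => ⟨hwab.1.trans hx.1, hx.2.trans ht⟩
  -- If the parameter of `γ w` is not between those of the end points, the curve has passed `γ t`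
  -- before time `w` or passes `γ s` after it. As it does not return, `γ w` is that end point.
  by_cases hmem : (φ (γ w)).1 ∈ uIcc (φ (γ s)).1 (φ (γ t)).1
  · exact ⟨hX (hγX w hwab), hI.uIcc_subset hse.2 hte.2 hmem⟩
  · have hcase : (φ (γ t)).1 ∈ uIcc (φ (γ s)).1 (φ (γ w)).1 ∨
        (φ (γ s)).1 ∈ uIcc (φ (γ w)).1 (φ (γ t)).1 := by
      simp only [mem_uIcc] at hmem ⊢
      by_contra hcon
      push Not at hcon hmem
      grind
    rcases hcase with hc | hc
    · obtain ⟨x, hx, hxt⟩ := intermediate_value_uIcc (f := fun x => (φ (γ x)).1) (by rwa [uIcc_of_le hw.1]) hc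
      rw [uIcc_of_le hw.1] at hx
      rw [hleft x hx (hinj x (hLe x hx) t htab hxt)]
      exact hte
    · obtain ⟨x, hx, hxs⟩ := intermediate_value_uIcc (f := fun x => (φ (γ x)).1) (by rwa [uIcc_of_le hw.2]) hc
      rw [uIcc_of_le hw.2] at hx
      rw [hright x hx (hinj x (hRe x hx) s hsab hxs)]
      exact hse

/-! ### The dyadic cubical decomposition of an open set -/

section Grid

variable {ι : Type}

/-- A face of the dyadic grid of mesh `2⁻ᵏ`, given by the level `k` and its extreme corners in units
of the mesh. -/
@[ext]
structure GridFace (ι : Type) where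
  level : ℕ
  lo : ι → ℤ
  hi : ι → ℤ

namespace GridFace

/-- The relatively open face. -/
def openSet (c : GridFace ι) : Set (ι → ℝ) :=
  {x | ∀ i, ⌊2 ^ c.level * x i⌋ = c.lo i ∧ ⌈2 ^ c.level * x i⌉ = c.hi i}

/-- The closed face. -/
def closedSet (c : GridFace ι) : Set (ι → ℝ) :=
  {x | ∀ i, (c.lo i : ℝ) ≤ 2 ^ c.level * x i ∧ 2 ^ c.level * x i ≤ c.hi i}

/-- The dimension of a face. -/
noncomputable def dim [Fintype ι] (c : GridFace ι) : ℕ :=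
  open Classical in (Finset.univ.filter fun i => c.lo i ≠ c.hi i).card

/-- The face of level `k` that contains `x` in its relative interior. -/
noncomputable def of (k : ℕ) (x : ι → ℝ) : GridFace ι :=
  ⟨k, fun i => ⌊2 ^ k * x i⌋, fun i => ⌈2 ^ k * x i⌉⟩

theorem mem_openSet_iff {c : GridFace ι} {x : ι → ℝ} : x ∈ c.openSet ↔ of c.level x = c := by
  constructor
  · intro h
    ext i
    · rfl
    · exact (h i).1
    · exact (h i).2
  · rintro h i
    exact ⟨congrFun (congrArg lo h) i, congrFun (congrArg hi h) i⟩

theorem openSet_subset_closedSet (c : GridFace ι) : c.openSet ⊆ c.closedSet := fun x hx i => by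
  rw [← (hx i).1, ← (hx i).2]
  exact ⟨Int.floor_le _, Int.le_ceil _⟩

theorem mem_openSet_of (k : ℕ) (x : ι → ℝ) : x ∈ (of k x).openSet := fun _ => ⟨rfl, rfl⟩

theorem convex_openSet (c : GridFace ι) : Convex ℝ c.openSet := by
  have : c.openSet = Set.pi univ fun i =>
      {t : ℝ | ⌊2 ^ c.level * t⌋ = c.lo i ∧ ⌈2 ^ c.level * t⌉ = c.hi i} := by
    ext x; simp [openSet]
  rw [this]
  refine convex_pi fun i _ => OrdConnected.convex ⟨?_⟩
  rintro s ⟨hs1, hs2⟩ t ⟨ht1, ht2⟩ u ⟨hsu, hut⟩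
  have hp : (0 : ℝ) ≤ 2 ^ c.level := by positivity
  have h1 := mul_le_mul_of_nonneg_left hsu hp
  have h2 := mul_le_mul_of_nonneg_left hut hp
  exact ⟨le_antisymm (ht1 ▸ Int.floor_mono h2) (hs1 ▸ Int.floor_mono h1),
    le_antisymm (ht2 ▸ Int.ceil_mono h2) (hs2 ▸ Int.ceil_mono h1)⟩

/-- Faces of finer grids are contained in faces of coarser ones. -/
theorem closedSet_of_anti {k l : ℕ} (hkl : k ≤ l) (x : ι → ℝ) :
    (of l x).closedSet ⊆ (of k x).closedSet := by
  intro y hy i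
  obtain ⟨m, rfl⟩ := Nat.exists_eq_add_of_le hkl
  obtain ⟨h1, h2⟩ := hy i
  simp only [of, pow_add] at h1 h2 ⊢
  have hm : (0 : ℝ) < 2 ^ m := by positivity
  have e1 : (2 : ℝ) ^ m * ⌊(2 : ℝ) ^ k * x i⌋ ≤ ⌊(2 : ℝ) ^ k * 2 ^ m * x i⌋ := by
    have : (2 : ℤ) ^ m * ⌊(2 : ℝ) ^ k * x i⌋ ≤ ⌊(2 : ℝ) ^ k * 2 ^ m * x i⌋ := by
      rw [Int.le_floor]
      push_cast
      nlinarith [Int.floor_le ((2 : ℝ) ^ k * x i)]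
    exact_mod_cast this
  have e2 : (⌈(2 : ℝ) ^ k * 2 ^ m * x i⌉ : ℝ) ≤ (2 : ℝ) ^ m * ⌈(2 : ℝ) ^ k * x i⌉ := by
    have : ⌈(2 : ℝ) ^ k * 2 ^ m * x i⌉ ≤ (2 : ℤ) ^ m * ⌈(2 : ℝ) ^ k * x i⌉ := by
      rw [Int.ceil_le]
      push_cast
      nlinarith [Int.le_ceil ((2 : ℝ) ^ k * x i)]
    exact_mod_cast this
  constructor
  · refine le_of_mul_le_mul_left ?_ hm
    linarith
  · refine le_of_mul_le_mul_left ?_ hm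
    linarith

theorem lo_le_hi (k : ℕ) (x : ι → ℝ) (i : ι) : (of k x).lo i ≤ (of k x).hi i :=
  Int.floor_le_ceil _

theorem hi_le_lo_add_one (k : ℕ) (x : ι → ℝ) (i : ι) : (of k x).hi i ≤ (of k x).lo i + 1 :=
  Int.ceil_le_floor_add_one _

theorem lo_eq_hi_iff {k : ℕ} {x : ι → ℝ} {i : ι} :
    (of k x).lo i = (of k x).hi i ↔ ∃ m : ℤ, 2 ^ k * x i = m := by
  constructor
  · intro h
    refine ⟨⌊2 ^ k * x i⌋, le_antisymm ?_ (Int.floor_le _)⟩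
    have h' : ⌊2 ^ k * x i⌋ = ⌈2 ^ k * x i⌉ := h
    rw [h']
    exact Int.le_ceil _
  · rintro ⟨m, hm⟩
    change ⌊2 ^ k * x i⌋ = ⌈2 ^ k * x i⌉
    rw [hm, Int.floor_intCast, Int.ceil_intCast]

/-- A coordinate that is integral in units of a mesh stays integral in units of a finer one. -/
theorem dim_of_anti [Fintype ι] {k l : ℕ} (hkl : k ≤ l) (x : ι → ℝ) :
    (of l x).dim ≤ (of k x).dim := by
  classical
  unfold dim
  refine Finset.card_le_card fun i hi => ?_
  simp only [Finset.mem_filter, Finset.mem_univ, true_and, ne_eq, lo_eq_hi_iff] at hi ⊢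
  rintro ⟨m, hm⟩
  obtain ⟨j, rfl⟩ := Nat.exists_eq_add_of_le hkl
  refine hi ⟨2 ^ j * m, ?_⟩
  push_cast
  rw [← hm]
  ring

/-- Points of the boundary of a face lie on faces of smaller dimension. -/
theorem dim_lt_of_boundary [Fintype ι] {k : ℕ} {x y : ι → ℝ} (hy : y ∈ (of k x).closedSet)
    (hy' : y ∉ (of k x).openSet) : (of k y).dim < (of k x).dim := by
  classical
  have hsub : ∀ i, (of k x).lo i = (of k x).hi i → (of k y).lo i = (of k x).lo i ∧
      (of k y).hi i = (of k x).lo i := by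
    intro i h
    obtain ⟨h1, h2⟩ := hy i
    rw [← h] at h2
    have : (2 : ℝ) ^ k * y i = (of k x).lo i := le_antisymm h2 h1
    simp only [of] at this ⊢
    rw [this]
    simp
  unfold dim
  refine Finset.card_lt_card ((Finset.ssubset_iff_of_subset fun i hi => ?_).2 ?_)
  · simp only [Finset.mem_filter, Finset.mem_univ, true_and, ne_eq] at hi ⊢
    intro h
    exact hi ((hsub i h).1.trans (hsub i h).2.symm)
  -- A direction in which `y` leaves the open face is a free direction of that face, and there `y`
  -- sits at an integral end, which makes the direction degenerate for `y`.
  · simp only [openSet, mem_ofPred_eq, not_forall] at hy'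
    obtain ⟨i, hi⟩ := hy'
    have hne : (of k x).lo i ≠ (of k x).hi i := fun h =>
      hi ⟨(hsub i h).1, (hsub i h).2.trans h⟩
    refine ⟨i, by simpa using hne, ?_⟩
    simp only [Finset.mem_filter, Finset.mem_univ, true_and, ne_eq, not_not]
    rw [lo_eq_hi_iff]
    have hlh : (of k x).hi i = (of k x).lo i + 1 :=
      le_antisymm (hi_le_lo_add_one k x i) (lt_of_le_of_ne (lo_le_hi k x i) hne)
    obtain ⟨h1, h2⟩ := hy i
    rcases h1.eq_or_lt with h | h
    · exact ⟨_, h.symm⟩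
    rcases h2.eq_or_lt with h' | h'
    · exact ⟨_, h'⟩
    · rw [hlh] at h'
      refine (hi ⟨?_, ?_⟩).elim
      · rw [Int.floor_eq_iff]
        push_cast at h'
        exact ⟨h.le, h'⟩
      · rw [hlh, Int.ceil_eq_iff]
        push_cast
        push_cast at h'
        exact ⟨by simpa using h, h'.le⟩

end GridFace

/-- The union of the closed cubes of mesh `2⁻ᵏ` that contain `x` is contained in `O`. -/
def IsDeep (O : Set (ι → ℝ)) (k : ℕ) (x : ι → ℝ) : Prop :=
  -- The unit intervals with integer end points that contain `t` fill `[⌈t⌉ - 1, ⌊t⌋ + 1]`, also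
  -- when `t` is an integer.
  ∀ y : ι → ℝ, (∀ i, (⌈2 ^ k * x i⌉ : ℝ) - 1 ≤ 2 ^ k * y i ∧
    2 ^ k * y i ≤ (⌊2 ^ k * x i⌋ : ℝ) + 1) → y ∈ O

/-- Every cube of the mesh that contains `x` contains its closed face, hence `y`. So depth passes
from the boundary of a face to its interior. -/
theorem IsDeep.of_mem_closedSet {O : Set (ι → ℝ)} {k : ℕ} {x y : ι → ℝ} (hy : IsDeep O k y)
    (h : y ∈ (GridFace.of k x).closedSet) : IsDeep O k x := by
  intro z hz
  refine hy z fun i => ?_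
  obtain ⟨h1, h2⟩ := h i
  obtain ⟨hz1, hz2⟩ := hz i
  have e1 : ⌈(2 : ℝ) ^ k * y i⌉ ≤ ⌈(2 : ℝ) ^ k * x i⌉ := Int.ceil_le.2 h2
  have e2 : ⌊(2 : ℝ) ^ k * x i⌋ ≤ ⌊(2 : ℝ) ^ k * y i⌋ := Int.le_floor.2 h1
  have e1' : (⌈(2 : ℝ) ^ k * y i⌉ : ℝ) ≤ ⌈(2 : ℝ) ^ k * x i⌉ := by exact_mod_cast e1
  have e2' : (⌊(2 : ℝ) ^ k * x i⌋ : ℝ) ≤ ⌊(2 : ℝ) ^ k * y i⌋ := by exact_mod_cast e2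
  exact ⟨by linarith, by linarith⟩

theorem IsDeep.closedSet_subset {O : Set (ι → ℝ)} {k : ℕ} {x : ι → ℝ} (hx : IsDeep O k x) :
    (GridFace.of k x).closedSet ⊆ O := by
  intro y hy
  refine hx y fun i => ?_
  obtain ⟨h1, h2⟩ := hy i
  simp only [GridFace.of] at h1 h2
  have e1 : (⌈(2 : ℝ) ^ k * x i⌉ : ℝ) ≤ ⌊(2 : ℝ) ^ k * x i⌋ + 1 := by
    exact_mod_cast Int.ceil_le_floor_add_one _
  exact ⟨by linarith, by linarith⟩

/-- A mesh below half the distance to the complement works uniformly near `x`. The uniform bound on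
the level and the boundedness of `V` yield local finiteness. -/
theorem eventually_isDeep [Fintype ι] {O : Set (ι → ℝ)} (hO : IsOpen O) {x : ι → ℝ} (hx : x ∈ O) :
    ∃ k, ∃ V, IsOpen V ∧ x ∈ V ∧ Bornology.IsBounded V ∧ ∀ y ∈ V, IsDeep O k y := by
  obtain ⟨r, hr, hball⟩ := Metric.isOpen_iff.1 hO x hx
  obtain ⟨k, hk⟩ := exists_pow_lt_of_lt_one (half_pos hr) (show (1 / 2 : ℝ) < 1 by norm_num)
  refine ⟨k, Metric.ball x (r / 2), Metric.isOpen_ball, Metric.mem_ball_self (half_pos hr),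
    Metric.isBounded_ball, fun y hy z hz => hball ?_⟩
  have hp : (0 : ℝ) < 2 ^ k := by positivity
  have hzy : dist z y ≤ (1 / 2) ^ k := by
    refine (dist_pi_le_iff (by positivity)).2 fun i => ?_
    obtain ⟨h1, h2⟩ := hz i
    have e1 := Int.le_ceil ((2 : ℝ) ^ k * y i)
    have e2 := Int.floor_le ((2 : ℝ) ^ k * y i)
    rw [Real.dist_eq, one_div, inv_pow, ← one_div, le_div_iff₀' hp, ← abs_of_pos hp, ← abs_mul,
      abs_le]
    exact ⟨by linarith, by linarith⟩
  have := dist_triangle z y x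
  rw [Metric.mem_ball] at hy ⊢
  linarith

open Classical in
/-- The first level at which the cubes around `x` are contained in `O`. -/
noncomputable def gridLevel (O : Set (ι → ℝ)) (x : ι → ℝ) : ℕ :=
  -- The default `0` is never taken at a point of an open `O`.
  if h : ∃ k, IsDeep O k x then Nat.find h else 0

/-- The cell of the cubical decomposition of `O` that contains `x`. -/
noncomputable def gridCell (O : Set (ι → ℝ)) (x : ι → ℝ) : GridFace ι :=
  GridFace.of (gridLevel O x) x

theorem gridLevel_le {O : Set (ι → ℝ)} {x : ι → ℝ} {k : ℕ} (h : IsDeep O k x) :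
    gridLevel O x ≤ k := by
  classical
  have h' : ∃ k, IsDeep O k x := ⟨k, h⟩
  rw [gridLevel, dif_pos h']
  exact Nat.find_min' h' h

theorem isDeep_gridLevel [Fintype ι] {O : Set (ι → ℝ)} (hO : IsOpen O) {x : ι → ℝ} (hx : x ∈ O) :
    IsDeep O (gridLevel O x) x := by
  classical
  obtain ⟨k, V, -, hxV, -, h⟩ := eventually_isDeep hO hx
  have h' : ∃ k, IsDeep O k x := ⟨k, h x hxV⟩
  rw [gridLevel, dif_pos h']
  exact Nat.find_spec h'

section

variable [Fintype ι] {O : Set (ι → ℝ)}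

theorem gridCell_closedSet_subset (hO : IsOpen O) {x : ι → ℝ} (hx : x ∈ O) :
    (gridCell O x).closedSet ⊆ O :=
  (isDeep_gridLevel hO hx).closedSet_subset

/-- Levels do not decrease when passing to the boundary of a cell. -/
theorem gridLevel_le_of_mem_closedSet (hO : IsOpen O) {x y : ι → ℝ} (hx : x ∈ O)
    (hy : y ∈ (gridCell O x).closedSet) : gridLevel O x ≤ gridLevel O y := by
  by_contra hlt
  push Not at hlt
  have hyO := gridCell_closedSet_subset hO hx hy
  -- A smaller level at `y` would already be deep at `x`, since the coarser face of `x` contains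
  -- `y`.
  exact absurd (gridLevel_le ((isDeep_gridLevel hO hyO).of_mem_closedSet
    (GridFace.closedSet_of_anti hlt.le x hy))) (not_le.2 hlt)

/-- The level is constant on an open cell, because depth at a given level depends only on the face;
hence the open cells partition `O`. -/
theorem gridCell_eq_iff (hO : IsOpen O) {x y : ι → ℝ} (hx : x ∈ O) :
    y ∈ (gridCell O x).openSet ↔ y ∈ O ∧ gridCell O y = gridCell O x := by
  constructor
  · intro hy
    have hyc := GridFace.openSet_subset_closedSet _ hy
    have hyO := gridCell_closedSet_subset hO hx hyc
    have hof : GridFace.of (gridLevel O x) y = GridFace.of (gridLevel O x) x :=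
      GridFace.mem_openSet_iff.1 hy
    have h1 := gridLevel_le_of_mem_closedSet hO hx hyc
    have h2 : gridLevel O y ≤ gridLevel O x := by
      refine gridLevel_le ((isDeep_gridLevel hO hx).of_mem_closedSet ?_)
      rw [hof]
      exact GridFace.openSet_subset_closedSet _ (GridFace.mem_openSet_of _ x)
    refine ⟨hyO, ?_⟩
    rw [gridCell, le_antisymm h2 h1, hof]
    rfl
  · rintro ⟨-, h⟩
    rw [← h]
    exact GridFace.mem_openSet_of _ _

/-- This puts attaching maps into the lower skeleton: at the level of `x` the dimension drops on the
boundary, and passing to the finer level of `y` does not raise it. -/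
theorem gridCell_dim_lt (hO : IsOpen O) {x y : ι → ℝ} (hx : x ∈ O)
    (hy : y ∈ (gridCell O x).closedSet) (hy' : y ∉ (gridCell O x).openSet) :
    (gridCell O y).dim < (gridCell O x).dim :=
  (GridFace.dim_of_anti (gridLevel_le_of_mem_closedSet hO hx hy) y).trans_lt
    (GridFace.dim_lt_of_boundary hy hy')

/-- The cubical decomposition is locally finite. -/
theorem locally_finite_gridCell (hO : IsOpen O) {x : ι → ℝ} (hx : x ∈ O) :
    ∃ V, IsOpen V ∧ x ∈ V ∧ (gridCell O '' V).Finite := by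
  obtain ⟨k, V, hV, hxV, hb, h⟩ := eventually_isDeep hO hx
  refine ⟨V, hV, hxV, ?_⟩
  obtain ⟨M, hM⟩ := hb.exists_norm_le
  have hfl : ∀ l : ℕ, ((GridFace.of l) '' V).Finite := by
    intro l
    set B : ℤ := ⌈(2 : ℝ) ^ l * M⌉ + 1
    have hfin : (Set.pi univ fun _ : ι => Icc (-B) B).Finite :=
      Set.Finite.pi fun _ => finite_Icc _ _
    refine ((hfin.prod hfin).image fun q => (⟨l, q.1, q.2⟩ : GridFace ι)).subset ?_
    rintro _ ⟨y, hy, rfl⟩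
    have hbd : ∀ i, |2 ^ l * y i| ≤ ((⌈(2 : ℝ) ^ l * M⌉ : ℤ) : ℝ) := fun i => by
      have h1 : |y i| ≤ M := (norm_le_pi_norm y i).trans (hM y hy)
      have hp : (0 : ℝ) < 2 ^ l := by positivity
      rw [abs_mul, abs_of_pos hp]
      exact (mul_le_mul_of_nonneg_left h1 hp.le).trans (Int.le_ceil _)
    refine ⟨(fun i => ⌊2 ^ l * y i⌋, fun i => ⌈2 ^ l * y i⌉), ⟨?_, ?_⟩, rfl⟩
    · intro i _
      obtain ⟨h1, h2⟩ := abs_le.1 (hbd i)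
      constructor
      · rw [Int.le_floor]; push_cast [B]; linarith
      · have : ⌊(2 : ℝ) ^ l * y i⌋ ≤ ⌈(2 : ℝ) ^ l * M⌉ := by
          have := (Int.floor_le ((2 : ℝ) ^ l * y i)).trans h2
          exact_mod_cast this
        simp only [B]
        linarith
    · intro i _
      obtain ⟨h1, h2⟩ := abs_le.1 (hbd i)
      constructor
      · have : -⌈(2 : ℝ) ^ l * M⌉ ≤ ⌈(2 : ℝ) ^ l * y i⌉ := by
          have := h1.trans (Int.le_ceil ((2 : ℝ) ^ l * y i))
          exact_mod_cast this
        simp only [B]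
        linarith
      · rw [Int.ceil_le]; push_cast [B]; linarith
  refine ((Finset.range (k + 1)).finite_toSet.biUnion fun l _ => hfl l).subset ?_
  rintro _ ⟨y, hy, rfl⟩
  refine mem_biUnion (x := gridLevel O y) ?_ ⟨y, hy, rfl⟩
  have := gridLevel_le (h y hy)
  simp
  omega

end

end Grid

/-! ### Characteristic maps and the CW structure -/

section Grid

variable {ι : Type} [Fintype ι]

namespace GridFace

/-- A numbering of the directions of a face. -/
noncomputable def directions (c : GridFace ι) : {i // c.lo i ≠ c.hi i} ≃ Fin c.dim :=
  open Classical in Fintype.equivFinOfCardEq (by rw [Fintype.card_subtype]; rfl)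

open Classical in
/-- The affine parametrization of a face by the cube. -/
noncomputable def param (c : GridFace ι) (y : Fin c.dim → ℝ) : ι → ℝ := fun i =>
  -- The unit ball of the sup norm is the cube `[-1, 1]ᵈ`; `(1 + y) / 2` moves each coordinate to
  -- `[0, 1]`.
  if h : c.lo i ≠ c.hi i then (c.lo i + (1 + y (c.directions ⟨i, h⟩)) / 2) / 2 ^ c.level
  else c.lo i / 2 ^ c.level

/-- The inverse of the parametrization. -/
noncomputable def coord (c : GridFace ι) (x : ι → ℝ) : Fin c.dim → ℝ := fun j =>
  2 * (2 ^ c.level * x (c.directions.symm j) - c.lo (c.directions.symm j)) - 1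

theorem continuous_param (c : GridFace ι) : Continuous c.param := by
  refine continuous_pi fun i => ?_
  by_cases h : c.lo i ≠ c.hi i
  · simp only [param, dif_pos h]; fun_prop
  · simp only [param, dif_neg h]; fun_prop

theorem continuous_coord (c : GridFace ι) : Continuous c.coord := by
  unfold coord; fun_prop

theorem param_of_ne (c : GridFace ι) (y : Fin c.dim → ℝ) {i : ι} (h : c.lo i ≠ c.hi i) :
    2 ^ c.level * c.param y i = c.lo i + (1 + y (c.directions ⟨i, h⟩)) / 2 := by
  have hp : (0 : ℝ) < 2 ^ c.level := by positivity
  simp only [param, dif_pos h]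
  field_simp

theorem param_of_eq (c : GridFace ι) (y : Fin c.dim → ℝ) {i : ι} (h : c.lo i = c.hi i) :
    2 ^ c.level * c.param y i = c.lo i := by
  have hp : (0 : ℝ) < 2 ^ c.level := by positivity
  simp only [param, dif_neg (not_not.2 h)]
  field_simp

theorem coord_param (c : GridFace ι) (y : Fin c.dim → ℝ) : c.coord (c.param y) = y := by
  funext j
  rw [coord, c.param_of_ne y (c.directions.symm j).2]
  simp only [Subtype.coe_eta, Equiv.apply_symm_apply]
  ring

theorem param_coord {c : GridFace ι} {x : ι → ℝ} (hx : x ∈ c.closedSet) :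
    c.param (c.coord x) = x := by
  funext i
  have hp : (0 : ℝ) < 2 ^ c.level := by positivity
  refine mul_left_cancel₀ hp.ne' ?_
  by_cases h : c.lo i = c.hi i
  · rw [c.param_of_eq _ h]
    obtain ⟨h1, h2⟩ := hx i
    rw [← h] at h2
    exact le_antisymm h1 h2
  · rw [c.param_of_ne _ h]
    simp only [coord, Equiv.symm_apply_apply]
    ring

variable {k : ℕ} {x : ι → ℝ}

theorem hi_eq_of_ne {ι : Type} {k : ℕ} {x : ι → ℝ} {i : ι}
    (h : (of k x).lo i ≠ (of k x).hi i) :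
    (of k x).hi i = (of k x).lo i + 1 :=
  le_antisymm (hi_le_lo_add_one k x i) (lt_of_le_of_ne (lo_le_hi k x i) h)

theorem param_mem_closedSet {y : Fin (of k x).dim → ℝ} (hy : y ∈ Metric.closedBall 0 1) :
    (of k x).param y ∈ (of k x).closedSet := by
  intro i
  by_cases h : (of k x).lo i = (of k x).hi i
  · rw [param_of_eq _ _ h, ← h]
    exact ⟨le_rfl, le_rfl⟩
  · rw [param_of_ne _ _ h, hi_eq_of_ne h]
    rw [mem_closedBall_zero_iff, pi_norm_le_iff_of_nonneg zero_le_one] at hy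
    have := abs_le.1 (hy ((of k x).directions ⟨i, h⟩))
    push_cast
    constructor <;> linarith [this.1, this.2]

theorem param_mem_openSet {y : Fin (of k x).dim → ℝ} (hy : y ∈ Metric.ball 0 1) :
    (of k x).param y ∈ (of k x).openSet := by
  intro i
  by_cases h : (of k x).lo i = (of k x).hi i
  · rw [param_of_eq _ _ h, ← h]
    simp
  · rw [param_of_ne _ _ h, hi_eq_of_ne h]
    rw [mem_ball_zero_iff, pi_norm_lt_iff zero_lt_one] at hy
    have := abs_lt.1 (hy ((of k x).directions ⟨i, h⟩))
    rw [Int.floor_eq_iff, Int.ceil_eq_iff]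
    push_cast
    refine ⟨⟨?_, ?_⟩, ?_, ?_⟩ <;> linarith [this.1, this.2]

theorem coord_mem_closedBall {z : ι → ℝ} (hz : z ∈ (of k x).closedSet) :
    (of k x).coord z ∈ Metric.closedBall 0 1 := by
  rw [mem_closedBall_zero_iff, pi_norm_le_iff_of_nonneg zero_le_one]
  intro j
  obtain ⟨h1, h2⟩ := hz ((of k x).directions.symm j)
  rw [hi_eq_of_ne ((of k x).directions.symm j).2] at h2
  push_cast at h2
  rw [Real.norm_eq_abs, abs_le, coord]
  constructor <;> linarith

theorem coord_mem_ball {z : ι → ℝ} (hz : z ∈ (of k x).openSet) :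
    (of k x).coord z ∈ Metric.ball 0 1 := by
  rw [mem_ball_zero_iff, pi_norm_lt_iff zero_lt_one]
  intro j
  obtain ⟨h1, h2⟩ := hz ((of k x).directions.symm j)
  rw [hi_eq_of_ne ((of k x).directions.symm j).2] at h2
  rw [Int.floor_eq_iff] at h1
  rw [Int.ceil_eq_iff] at h2
  push_cast at h2
  rw [Real.norm_eq_abs, abs_lt, coord]
  constructor <;> linarith [h1.2, h2.1]

theorem image_param_ball : (of k x).param '' Metric.ball 0 1 = (of k x).openSet := by
  ext z
  constructor
  · rintro ⟨y, hy, rfl⟩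
    exact param_mem_openSet hy
  · intro hz
    exact ⟨_, coord_mem_ball hz, param_coord (openSet_subset_closedSet _ hz)⟩

theorem image_param_closedBall : (of k x).param '' Metric.closedBall 0 1 = (of k x).closedSet := by
  ext z
  constructor
  · rintro ⟨y, hy, rfl⟩
    exact param_mem_closedSet hy
  · intro hz
    exact ⟨_, coord_mem_closedBall hz, param_coord hz⟩

theorem closedSet_eq_closure : (of k x).closedSet = closure (of k x).openSet := by
  refine subset_antisymm ?_ (closure_minimal (openSet_subset_closedSet _) ?_)
  · rw [← image_param_closedBall, ← image_param_ball, ← closure_ball _ one_ne_zero]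
    exact (continuous_param _).continuousOn.image_closure
  · rw [← image_param_closedBall]
    exact ((isCompact_closedBall _ _).image (continuous_param _)).isClosed

theorem isCompact_closedSet : IsCompact (of k x).closedSet := by
  rw [← image_param_closedBall]
  exact (isCompact_closedBall _ _).image (continuous_param _)

end GridFace

variable {O : Set (ι → ℝ)}

theorem finite_gridCell_of_isCompact (hO : IsOpen O) {C : Set (ι → ℝ)} (hC : IsCompact C)
    (hCO : C ⊆ O) : (gridCell O '' C).Finite := by
  choose! V hV hxV hfin using fun x (hx : x ∈ O) => locally_finite_gridCell hO hx
  obtain ⟨t, htC, ht⟩ := hC.elim_nhds_subcover V fun x hx => (hV x (hCO hx)).mem_nhds (hxV x (hCO hx))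
  refine (t.finite_toSet.biUnion fun x hx => hfin x (hCO (htC x hx))).subset ?_
  rintro _ ⟨y, hy, rfl⟩
  obtain ⟨x, hx, hyx⟩ := mem_iUnion₂.1 (ht hy)
  exact mem_biUnion hx ⟨y, hyx, rfl⟩

/-- The cells of dimension `d` of the cubical decomposition of `O`. -/
def GridCellIndex (O : Set (ι → ℝ)) (d : ℕ) : Type :=
  {c : GridFace ι // (∃ x ∈ O, gridCell O x = c) ∧ c.dim = d}

section

variable {Y : Type} [TopologicalSpace Y] [Nonempty Y] {ψ : Y → ι → ℝ}

omit [Fintype ι] in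
theorem image_embedding_symm (hψ : IsOpenEmbedding ψ) {S : Set (ι → ℝ)} (hS : S ⊆ range ψ) :
    (hψ.toOpenPartialHomeomorph ψ).symm '' S = ψ ⁻¹' S := by
  ext q
  constructor
  · rintro ⟨z, hz, rfl⟩
    rw [mem_preimage, hψ.toOpenPartialHomeomorph_right_inv ψ (hS hz)]
    exact hz
  · intro hq
    exact ⟨ψ q, hq, hψ.toOpenPartialHomeomorph_left_inv ψ⟩

/-- The underlying function of a characteristic map. -/
noncomputable def gridMapFun (hψ : IsOpenEmbedding ψ) (d : ℕ) (c : GridCellIndex (range ψ) d)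
    (y : Fin d → ℝ) : Y :=
  (hψ.toOpenPartialHomeomorph ψ).symm (c.1.param (y ∘ Fin.cast c.2.2))

variable {d : ℕ}

theorem GridCellIndex.openSet_subset (hO : IsOpen O) (c : GridCellIndex O d) :
    c.1.openSet ⊆ O := by
  obtain ⟨_, ⟨x, hx, rfl⟩, rfl⟩ := c
  exact (GridFace.openSet_subset_closedSet _).trans (gridCell_closedSet_subset hO hx)

theorem GridCellIndex.closedSet_subset (hO : IsOpen O) (c : GridCellIndex O d) :
    c.1.closedSet ⊆ O := by
  obtain ⟨_, ⟨x, hx, rfl⟩, rfl⟩ := c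
  exact gridCell_closedSet_subset hO hx

theorem GridCellIndex.mem_openSet_iff (hO : IsOpen O) (c : GridCellIndex O d) {z : ι → ℝ} :
    z ∈ c.1.openSet ↔ z ∈ O ∧ gridCell O z = c.1 := by
  obtain ⟨_, ⟨x, hx, rfl⟩, rfl⟩ := c
  exact gridCell_eq_iff hO hx

theorem image_gridMapFun_ball (hψ : IsOpenEmbedding ψ) (c : GridCellIndex (range ψ) d) :
    gridMapFun hψ d c '' Metric.ball 0 1 = ψ ⁻¹' c.1.openSet := by
  rw [← image_embedding_symm hψ (c.openSet_subset hψ.isOpen_range)]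
  obtain ⟨_, ⟨x, hx, rfl⟩, rfl⟩ := c
  change _ = _ '' (GridFace.of _ x).openSet
  rw [← GridFace.image_param_ball, image_image]
  rfl

theorem image_gridMapFun_closedBall (hψ : IsOpenEmbedding ψ) (c : GridCellIndex (range ψ) d) :
    gridMapFun hψ d c '' Metric.closedBall 0 1 = ψ ⁻¹' c.1.closedSet := by
  rw [← image_embedding_symm hψ (c.closedSet_subset hψ.isOpen_range)]
  obtain ⟨_, ⟨x, hx, rfl⟩, rfl⟩ := c
  change _ = _ '' (GridFace.of _ x).closedSet
  rw [← GridFace.image_param_closedBall, image_image]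
  rfl

theorem continuousOn_gridMapFun (hψ : IsOpenEmbedding ψ) (c : GridCellIndex (range ψ) d) :
    ContinuousOn (gridMapFun hψ d c) (Metric.closedBall 0 1) := by
  have hsub := c.closedSet_subset hψ.isOpen_range
  obtain ⟨_, ⟨x, hx, rfl⟩, rfl⟩ := c
  have hc := (hψ.toOpenPartialHomeomorph ψ).continuousOn_symm
  rw [hψ.toOpenPartialHomeomorph_target] at hc
  exact hc.comp (GridFace.continuous_param _).continuousOn
    fun y hy => hsub (GridFace.param_mem_closedSet hy)

theorem coord_gridMapFun (hψ : IsOpenEmbedding ψ) (c : GridCellIndex (range ψ) d)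
    {y : Fin d → ℝ} (hy : y ∈ Metric.closedBall 0 1) :
    c.1.coord (ψ (gridMapFun hψ d c y)) ∘ Fin.cast c.2.2.symm = y := by
  have hsub := c.closedSet_subset hψ.isOpen_range
  obtain ⟨_, ⟨x, hx, rfl⟩, rfl⟩ := c
  have h : ψ (gridMapFun hψ _ ⟨_, ⟨x, hx, rfl⟩, rfl⟩ y) = (gridCell (range ψ) x).param y :=
    hψ.toOpenPartialHomeomorph_right_inv ψ (hsub (GridFace.param_mem_closedSet hy))
  rw [h]
  exact GridFace.coord_param _ _

theorem gridMapFun_coord (hψ : IsOpenEmbedding ψ) (c : GridCellIndex (range ψ) d) {q : Y}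
    (hq : ψ q ∈ c.1.closedSet) :
    gridMapFun hψ d c (c.1.coord (ψ q) ∘ Fin.cast c.2.2.symm) = q := by
  obtain ⟨_, ⟨x, hx, rfl⟩, rfl⟩ := c
  have h : gridMapFun hψ _ ⟨_, ⟨x, hx, rfl⟩, rfl⟩ ((gridCell (range ψ) x).coord (ψ q)) =
      (hψ.toOpenPartialHomeomorph ψ).symm
        ((gridCell (range ψ) x).param ((gridCell (range ψ) x).coord (ψ q))) := rfl
  have h2 : (gridCell (range ψ) x).param ((gridCell (range ψ) x).coord (ψ q)) = ψ q :=
    GridFace.param_coord hq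
  rw [h2, hψ.toOpenPartialHomeomorph_left_inv] at h
  exact h

theorem coord_mem_ball_of_mem (c : GridCellIndex O d) {z : ι → ℝ} (hz : z ∈ c.1.openSet) :
    c.1.coord z ∘ Fin.cast c.2.2.symm ∈ Metric.ball (0 : Fin d → ℝ) 1 := by
  obtain ⟨_, ⟨x, hx, rfl⟩, rfl⟩ := c
  exact GridFace.coord_mem_ball hz

/-- The characteristic map of a cell of dimension `d`. -/
noncomputable def gridMap (hψ : IsOpenEmbedding ψ) (d : ℕ) (c : GridCellIndex (range ψ) d) :
    PartialEquiv (Fin d → ℝ) Y where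
  toFun := gridMapFun hψ d c
  invFun q := c.1.coord (ψ q) ∘ Fin.cast c.2.2.symm
  source := Metric.ball 0 1
  target := ψ ⁻¹' c.1.openSet
  map_source' _ hy := image_gridMapFun_ball hψ c ▸ mem_image_of_mem _ hy
  map_target' _ hq := coord_mem_ball_of_mem c hq
  left_inv' _ hy := coord_gridMapFun hψ c (Metric.ball_subset_closedBall hy)
  right_inv' _ hq := gridMapFun_coord hψ c (GridFace.openSet_subset_closedSet _ hq)

theorem image_sphere_gridMapFun (hψ : IsOpenEmbedding ψ) (c : GridCellIndex (range ψ) d)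
    {y : Fin d → ℝ} (hy : y ∈ Metric.sphere 0 1) :
    ψ (gridMapFun hψ d c y) ∈ c.1.closedSet \ c.1.openSet := by
  have hy' := Metric.sphere_subset_closedBall hy
  constructor
  · have := mem_image_of_mem (gridMapFun hψ d c) hy'
    rwa [image_gridMapFun_closedBall] at this
  · intro h
    have := coord_mem_ball_of_mem c h
    rw [coord_gridMapFun hψ c hy', mem_ball_zero_iff] at this
    rw [mem_sphere_zero_iff_norm] at hy
    exact this.ne hy

/-- A cell of the decomposition, as an index in its dimension. -/
noncomputable def GridCellIndex.ofPoint {z : ι → ℝ} (hz : z ∈ O) :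
    GridCellIndex O (gridCell O z).dim := ⟨gridCell O z, ⟨z, hz, rfl⟩, rfl⟩

-- An open set that meets a closed cell meets the open cell, so local finiteness of the open cells
-- passes to the closed ones.
omit [Nonempty Y] in
theorem locallyFinite_gridMap (hψ : IsOpenEmbedding ψ) :
    LocallyFinite fun p : Σ d, GridCellIndex (range ψ) d => ψ ⁻¹' p.2.1.closedSet := by
  have hO := hψ.isOpen_range
  intro q
  obtain ⟨V, hV, hqV, hfin⟩ := locally_finite_gridCell hO (mem_range_self q)
  refine ⟨ψ ⁻¹' V, (hV.preimage hψ.continuous).mem_nhds hqV, ?_⟩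
  refine Finite.of_finite_image (f := fun p : Σ d, GridCellIndex (range ψ) d => p.2.1)
    (hfin.subset ?_) ?_
  · rintro _ ⟨⟨d, c⟩, ⟨r, hr, hrV⟩, rfl⟩
    have hcl : c.1.closedSet = closure c.1.openSet := by
      obtain ⟨_, ⟨x, hx, rfl⟩, rfl⟩ := c
      exact GridFace.closedSet_eq_closure
    rw [mem_preimage, hcl] at hr
    obtain ⟨z, hzV, hz⟩ := mem_closure_iff.1 hr V hV hrV
    exact ⟨z, hzV, ((c.mem_openSet_iff hO).1 hz).2⟩
  · rintro ⟨d, c, hc, rfl⟩ - ⟨d', c', hc', rfl⟩ - h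
    obtain rfl : c = c' := h
    rfl

/-- The cubical decomposition of a space that embeds as an open set in a real vector space. -/
@[reducible]
noncomputable def gridComplex (hψ : IsOpenEmbedding ψ) : CWComplex (univ : Set Y) where
  cell d := GridCellIndex (range ψ) d
  map d c := gridMap hψ d c
  source_eq _ _ := rfl
  continuousOn _ c := continuousOn_gridMapFun hψ c
  continuousOn_symm _ c := by
    change ContinuousOn (fun q => c.1.coord (ψ q) ∘ Fin.cast c.2.2.symm) _
    refine Continuous.continuousOn ?_
    have := (c.1.continuous_coord).comp hψ.continuous
    exact continuous_pi fun j => (continuous_apply _).comp this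
  pairwiseDisjoint' := by
    rintro ⟨d, c⟩ - ⟨d', c'⟩ - hne
    change Disjoint (gridMapFun hψ d c '' _) (gridMapFun hψ d' c' '' _)
    rw [image_gridMapFun_ball, image_gridMapFun_ball, Set.disjoint_left]
    intro q hq hq'
    have h1 := ((c.mem_openSet_iff hψ.isOpen_range).1 hq).2
    have h2 := ((c'.mem_openSet_iff hψ.isOpen_range).1 hq').2
    obtain ⟨c, hc, rfl⟩ := c
    obtain ⟨c', hc', rfl⟩ := c'
    obtain rfl : c = c' := h1.symm.trans h2
    exact hne rfl
  mapsTo' d c := by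
    classical
    have hO := hψ.isOpen_range
    have hsub := c.closedSet_subset hO
    -- Closure finiteness: a closed cell is compact, so local finiteness lets it meet only finitely
    -- many open cells.
    have hfin : (gridCell (range ψ) '' c.1.closedSet).Finite := by
      refine finite_gridCell_of_isCompact hO ?_ hsub
      obtain ⟨_, ⟨x, hx, rfl⟩, rfl⟩ := c
      exact GridFace.isCompact_closedSet
    have hfin' : ∀ m, {e : GridCellIndex (range ψ) m |
        e.1 ∈ gridCell (range ψ) '' c.1.closedSet}.Finite := fun m =>
      hfin.preimage Subtype.val_injective.injOn
    refine ⟨fun m => (hfin' m).toFinset, fun y hy => ?_⟩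
    obtain ⟨h1, h2⟩ := image_sphere_gridMapFun hψ c hy
    set z := ψ (gridMapFun hψ d c y) with hz
    have hzO := hsub h1
    have hdim : (gridCell (range ψ) z).dim < d := by
      obtain ⟨_, ⟨x, hx, rfl⟩, rfl⟩ := c
      exact gridCell_dim_lt hO hx h1 h2
    simp only [mem_iUnion]
    refine ⟨_, hdim, GridCellIndex.ofPoint hzO, ?_, ?_⟩
    · rw [Set.Finite.mem_toFinset]
      exact ⟨z, h1, rfl⟩
    · change _ ∈ gridMapFun hψ _ _ '' _
      rw [image_gridMapFun_closedBall]
      exact GridFace.openSet_subset_closedSet _ (GridFace.mem_openSet_of _ _)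
  closed' A _ hA := by
    -- The weak topology condition: `A` is the union of its traces on a locally finite family of
    -- closed cells.
    have hAeq : A = ⋃ p : Σ d, GridCellIndex (range ψ) d, A ∩ ψ ⁻¹' p.2.1.closedSet := by
      ext q
      simp only [mem_iUnion]
      refine ⟨fun hq => ⟨⟨_, GridCellIndex.ofPoint (mem_range_self q)⟩, hq, ?_⟩,
        fun ⟨_, h⟩ => h.1⟩
      exact GridFace.openSet_subset_closedSet _ (GridFace.mem_openSet_of _ _)
    rw [hAeq]
    refine ((locallyFinite_gridMap hψ).subset fun p => inter_subset_right).isClosed_iUnion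
      fun p => ?_
    have := hA p.1 p.2
    change IsClosed (A ∩ gridMapFun hψ _ _ '' _) at this
    rwa [image_gridMapFun_closedBall] at this
  union' := by
    refine eq_univ_of_forall fun q => ?_
    simp only [mem_iUnion]
    refine ⟨_, GridCellIndex.ofPoint (mem_range_self q), ?_⟩
    change _ ∈ gridMapFun hψ _ _ '' _
    rw [image_gridMapFun_closedBall]
    exact GridFace.openSet_subset_closedSet _ (GridFace.mem_openSet_of _ _)

/-- A space that embeds as an open set in a real vector space has a cell decomposition with convex
cells. -/
theorem exists_convex_cells (hψ : IsOpenEmbedding ψ) :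
    ∃ K : CWComplex (univ : Set Y), ∀ (d : ℕ) (c : K.cell d),
      ∃ B : Set (ι → ℝ), Convex ℝ B ∧ B ⊆ range ψ ∧ K.map d c '' Metric.ball 0 1 = ψ ⁻¹' B :=
  ⟨gridComplex hψ, fun _ c => ⟨c.1.openSet, c.1.convex_openSet, c.openSet_subset hψ.isOpen_range,
    image_gridMapFun_ball hψ c⟩⟩

end

end Grid

/-! ### Cell decompositions of `X` and the theorem -/

/-- `X` has a cell decomposition whose cells shortest curves in `X` meet finitely many times. -/
theorem exists_cellDecomposition_of_finite {X : Set Plane} (hX : X.Finite) :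
    ∃ K : CellDecomposition X, ∀ (γ : ℝ → Plane) (a b : ℝ), IsShortestCurve X γ a b →
      ∀ (n : ℕ) (i : K.cell n), InteractsFinitely γ a b (K.openCell n i) := by
  have := hX.to_subtype
  refine ⟨CWComplex.ofDiscreteTopology, fun γ a b h n i => h.interactsFinitely_of_convex ?_ ?_⟩
  · refine Set.Subsingleton.convex ?_
    match n, i with
    | 0, i => exact ((subsingleton_of_subsingleton (s := Metric.ball 0 1)).image _).image _
    | _ + 1, i => exact i.elim
  · rintro _ ⟨p, -, rfl⟩
    exact p.2

/-- The identification of the plane with `Fin 2 → ℝ` is linear, so the grid cells are convex subsets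
of `X`. -/
theorem exists_cellDecomposition_of_isOpen {X : Set Plane} (hX : IsOpen X) (hne : X.Nonempty) :
    ∃ K : CellDecomposition X, ∀ (γ : ℝ → Plane) (a b : ℝ), IsShortestCurve X γ a b →
      ∀ (n : ℕ) (i : K.cell n), InteractsFinitely γ a b (K.openCell n i) := by
  have := hne.to_subtype
  let e := EuclideanSpace.equiv (Fin 2) ℝ
  have hψ : IsOpenEmbedding fun p : X => e p :=
    e.toHomeomorph.isOpenEmbedding.comp hX.isOpenEmbedding_subtypeVal
  obtain ⟨K, hK⟩ := exists_convex_cells hψ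
  refine ⟨K, fun γ a b h n i => ?_⟩
  obtain ⟨B, hB, hBX, hKB⟩ := hK n i
  have hcell : CellDecomposition.openCell K n i = e ⁻¹' B := by
    rw [CellDecomposition.openCell, hKB]
    ext p
    refine ⟨fun ⟨q, hq, hqp⟩ => hqp ▸ hq, fun hp => ?_⟩
    obtain ⟨q, hq⟩ := hBX hp
    exact ⟨q, show e q ∈ B from e.injective hq ▸ hp, e.injective hq⟩
  refine h.interactsFinitely_of_convex ?_ ?_
  · rw [hcell]
    exact hB.linear_preimage e.toLinearMap
  · rintro _ ⟨p, -, rfl⟩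
    exact p.2

/-- The line coordinate makes the arc an open subset of `Fin 1 → ℝ`, whose convex cells correspond
to sub-arcs over intervals. -/
theorem exists_cellDecomposition_of_chartArc {φ : Plane ≃ₜ ℝ × ℝ} {O : Set ℝ} (hO : IsOpen O)
    (hne : (chartArc φ O).Nonempty) :
    ∃ K : CellDecomposition (chartArc φ O), ∀ (γ : ℝ → Plane) (a b : ℝ),
      IsShortestCurve (chartArc φ O) γ a b →
        ∀ (n : ℕ) (i : K.cell n), InteractsFinitely γ a b (K.openCell n i) := by
  have := hne.to_subtype
  let ψ : chartArc φ O → Fin 1 → ℝ := fun p _ => (φ p).1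
  have hrange : range ψ = {v | v 0 ∈ O} := by
    ext v
    constructor
    · rintro ⟨p, rfl⟩
      exact p.2.2
    · intro hv
      refine ⟨⟨φ.symm (v 0, 0), symm_mem_chartAxis φ _, ?_⟩, ?_⟩
      · rw [φ.apply_symm_apply]
        exact hv
      · funext i
        rw [Subsingleton.elim i 0]
        simp [ψ]
  have hleft : ∀ p : chartArc φ O, φ.symm (ψ p 0, 0) = p := fun p =>
    (mem_chartAxis_iff.1 p.2.1).symm
  have hψ : IsOpenEmbedding ψ := by
    refine ⟨IsEmbedding.of_comp (by fun_prop)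
      (g := fun v : Fin 1 → ℝ => φ.symm (v 0, 0)) (by fun_prop) ?_, ?_⟩
    · rw [show (fun v : Fin 1 → ℝ => φ.symm (v 0, 0)) ∘ ψ = Subtype.val from funext hleft]
      exact IsEmbedding.subtypeVal
    · rw [hrange]
      exact hO.preimage (continuous_apply 0)
  obtain ⟨K, hK⟩ := exists_convex_cells hψ
  refine ⟨K, fun γ a b h n i => ?_⟩
  obtain ⟨B, hB, hBX, hKB⟩ := hK n i
  have hcell : CellDecomposition.openCell K n i = chartArc φ {u | (fun _ => u) ∈ B} := by
    rw [CellDecomposition.openCell, hKB]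
    ext p
    constructor
    · rintro ⟨q, hq, rfl⟩
      exact ⟨q.2.1, hq⟩
    · rintro ⟨hp, hpB⟩
      have hpO : (φ p).1 ∈ O := (hrange ▸ hBX) hpB
      exact ⟨⟨p, hp, hpO⟩, hpB, rfl⟩
  rw [hcell]
  refine h.interactsFinitely_of_arc (fun p hp => hp.1) (Convex.ordConnected ?_)
  exact hB.linear_preimage (LinearMap.pi fun _ : Fin 1 => LinearMap.id (R := ℝ) (M := ℝ))

theorem theorem4p5 (m k : ℕ)
    (g : Fin m → Polynomial ℝ) (θ : Fin m → ℝ) (f : Fin k → Polynomial ℝ) (β : Fin k → ℝ)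
    (X : Set Plane)
    (hX : X = (⋂ i, polyCurve (g i) (θ i)) ∩ ⋂ j, openPolyHalfPlane (f j) (β j)) :
    (X = ∅ ∨ X.Finite ∨
      (∃ (h : Polynomial ℝ) (φ : ℝ), IsFiniteDisjointUnionOf (IsOpenPolyCurveOn h φ) X) ∨
      IsFiniteDisjointUnionOf IsTypeIIRegion X) ∧
    ∃ K : CellDecomposition X, ∀ (γ : ℝ → Plane) (a b : ℝ), IsShortestCurve X γ a b →
      ∀ (n : ℕ) (i : K.cell n), InteractsFinitely γ a b (K.openCell n i) := by
  -- This also covers the empty set, so `X` is nonempty from here on, as the embeddings behind the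
  -- grid decomposition require.
  by_cases hfin : X.Finite
  · exact ⟨Or.inr (Or.inl hfin), exists_cellDecomposition_of_finite hfin⟩
  have hne : X.Nonempty := (Set.Infinite.nonempty hfin)
  rcases Nat.eq_zero_or_pos m with rfl | hm
  · rw [iInter_of_empty, univ_inter] at hX
    refine ⟨Or.inr (Or.inr (Or.inr (hX ▸ isFiniteDisjointUnionOf_typeII f β))),
      exists_cellDecomposition_of_isOpen ?_ hne⟩
    rw [hX]
    exact isOpen_iInter_of_finite fun j =>
      isOpen_lt continuous_const (continuous_rotatedFun (f j) (β j))
  · rcases finite_or_eq_polyArc g θ f β ⟨0, hm⟩ with h | ⟨O, hO, hOfin, h⟩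
    · exact absurd (hX ▸ h) hfin
    · obtain rfl := hX.trans h
      exact ⟨Or.inr (Or.inr (Or.inl ⟨_, _, isFiniteDisjointUnionOf_openPolyCurve _ _ hO hOfin⟩)),
        exists_cellDecomposition_of_chartArc (φ := polyChart _ _) hO hne⟩
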